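/- \textbf{Chord diagrams.} A chord diagram $D$ of degree $k$ on a string link with two components consists of two oriented segments (numbered $1,2$) and $k$ chords whose $2k$ endpoints are distinct points of the segments, up to the order of the endpoints along each segment. Its intersection graph $\Gamma(D)$ has the chords as vertices, each vertex $v$ labelled by the unordered pair $\{a_v,b_v\}$ of components carrying its two endpoints; for distinct chords $v,w$ there is a directed edge from $v$ to $w$ if and only if the number of pairs ($e_1$ an endpoint of $v$, $e_2$ an endpoint of $w$) lying on the same segment with $e_1$ before $e_2$ is odd. The adjacency matrix of $\Gamma(D)$ is the $k\times k$ matrix over $\mathbb Z/2$ whose $(v,w)$ entry for $v\ne w$ is $1$ if there is a directed edge from $v$ to $w$ and $0$ otherwise, and whose $(v,v)$ entry is $1$ if $a_v\ne b_v$ and $0$ if $a_v=b_v$. \textbf{The Homfly regular weight system.} Let $P(l,m)\in\mathbb Z[l^{\pm1},m^{\pm1}]$ be the Homfly polynomial of framed oriented links: $P(L_+)-P(L_-)=mP(L_0)$ for a skein triple, $P(L^+)=lP(L)$ when $L^+$ is $L$ with a positive kink added, $P(L\cup O)=\frac{l-l^{-1}}{m}P(L)$ for a split unknot $O$, and $P(O)=1$.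 Here links are presented as closures of braids with the blackboard framing, and singular links (with finitely many double points) as closures of singular braids. Extend $P$ to singular links by $P(\text{double point})=P(\text{positive crossing})-P(\text{negative crossing})$, and substitute $m=e^{ax/2}-e^{-ax/2}$, $l=e^{abx/2}$, where $a\neq0$ and $b$ are elements of a field $K$ of characteristic $0$ (for instance the indeterminates of $K=\mathbb Q(a,b)$), to obtain a Laurent series in $x$ over $K$. A singular string link (the partial closure of a singular braid, its strings running from bottom to top) with $k$ double points has chord diagram $D$ if the double points met along its strings come in the order of the endpoints of the chords of $D$. Write $H(D)=h$ if singular string links with chord diagram $D$ exist and, for every one of them, the series obtained from its closure has zero coefficient at $x^j$ for all $j<k$ and coefficient $h$ at $x^k$. \textbf{Theorem.} For every chord diagram $D$ of degree $k\ge 0$ on a string link with two components, let $r$ be the rank over $\mathbb Z/2$ of the adjacency matrix of $\Gamma(D)$. Then the value $H(D)$ exists, and $$H(D)=a^k b^{k-r}\ \text{ if } r \text{ is odd},\qquad H(D)=a^k b^{k-r+1}\ \text{ if } r \text{ is even}.$$ -/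

import Mathlib

/-! ### Chord diagrams on string links and their intersection graphs -/

/-- A string link chord diagram with `m` components and `k` chords (named by `Fin k`).  Each
component is an oriented segment, and the diagram is the record of the chord endpoints met along
each component, read from bottom to top; every chord has exactly two endpoints. -/
structure ChordDiagram (m k : ℕ) where
  word : Fin m → List (Fin k)
  two_endpoints : ∀ v : Fin k, ∑ i, (word i).count v = 2

/-- A directed graph (edges counted mod 2) with vertices labelled by unordered pairs of colors in
`Fin m`; the pair `{i, j}` (possibly `i = j`) is the multiset with these two elements. -/
structure LabeledDigraph (m k : ℕ) where
  label : Fin k → Multiset (Fin m)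
  edge : Fin k → Fin k → Prop

open Classical in
/-- The number of pairs `(p, q)` of places of `L` with `p` before `q`, `v` at `p` and `w` at
`q`. -/
noncomputable def countBefore {k : ℕ} (L : List (Fin k)) (v w : Fin k) : ℕ :=
  (Finset.univ.filter fun pq : Fin L.length × Fin L.length =>
    pq.1 < pq.2 ∧ L.get pq.1 = v ∧ L.get pq.2 = w).card

/-- The intersection graph: a vertex for each chord, labelled by the components of its two
endpoints, and one directed edge from `v` to `w` for each pair (endpoint of `v`, endpoint of `w`)
on a common component with the first below the second, counted mod 2. -/
noncomputable def ChordDiagram.intersectionGraph {m k : ℕ} (D : ChordDiagram m k) :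
    LabeledDigraph m k where
  label v := ∑ i, Multiset.replicate ((D.word i).count v) i
  edge v w := v ≠ w ∧ Odd (∑ i, countBefore (D.word i) v w)

open Classical in
/-- The adjacency matrix over `ℤ/2`: off the diagonal it records the directed edges, and the
diagonal entry of `v` is `0` if the two colors of the label of `v` agree and `1` otherwise. -/
noncomputable def LabeledDigraph.adj {m k : ℕ} (G : LabeledDigraph m k) :
    Matrix (Fin k) (Fin k) (ZMod 2) :=
  Matrix.of fun v w =>
    if v = w then (if ∃ i, G.label v = {i, i} then 0 else 1)
    else (if G.edge v w then 1 else 0)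

/-! ### Braids -/

/-- The relators of the braid group with `n` generators: distant generators commute, adjacent
ones satisfy the braid relation. -/
def braidRels (n : ℕ) : Set (FreeGroup (Fin n)) :=
  {r | (∃ i j : Fin n, (i : ℕ) + 1 < j ∧
          r = FreeGroup.of i * FreeGroup.of j * (FreeGroup.of j * FreeGroup.of i)⁻¹) ∨
       (∃ i j : Fin n, (i : ℕ) + 1 = j ∧
          r = FreeGroup.of i * FreeGroup.of j * FreeGroup.of i *
            (FreeGroup.of j * FreeGroup.of i * FreeGroup.of j)⁻¹)}

/-- The braid group on `n + 1` strands (with `n` standard generators). -/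
abbrev Braid (n : ℕ) : Type := PresentedGroup (braidRels n)

/-- The standard generator: a positive crossing of the strands in places `i` and `i + 1`. -/
def Braid.σ {n : ℕ} (i : Fin n) : Braid n := PresentedGroup.of i

/-- Adding a trivial strand on the right. -/
def Braid.addStrand (n : ℕ) : Braid n →* Braid (n + 1) :=
  PresentedGroup.toGroup (f := fun i : Fin n => Braid.σ i.castSucc) (by
    have key : ∀ x y : FreeGroup (Fin (n + 1)), x * y⁻¹ ∈ braidRels (n + 1) →
        PresentedGroup.mk (braidRels (n + 1)) x = PresentedGroup.mk (braidRels (n + 1)) y := by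
      intro x y h
      have h1 := PresentedGroup.one_of_mem h
      rwa [map_mul, map_inv, mul_inv_eq_one] at h1
    rintro r (⟨i, j, hij, rfl⟩ | ⟨i, j, hij, rfl⟩)
    · have := key (FreeGroup.of i.castSucc * FreeGroup.of j.castSucc)
        (FreeGroup.of j.castSucc * FreeGroup.of i.castSucc)
        (Or.inl ⟨i.castSucc, j.castSucc, by simpa using hij, rfl⟩)
      simp only [map_mul, map_inv, FreeGroup.lift_apply_of, mul_inv_eq_one]
      simp only [map_mul] at this
      exact this
    · have := key (FreeGroup.of i.castSucc * FreeGroup.of j.castSucc * FreeGroup.of i.castSucc)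
        (FreeGroup.of j.castSucc * FreeGroup.of i.castSucc * FreeGroup.of j.castSucc)
        (Or.inr ⟨i.castSucc, j.castSucc, by simpa using hij, rfl⟩)
      simp only [map_mul, map_inv, FreeGroup.lift_apply_of, mul_inv_eq_one]
      simp only [map_mul] at this
      exact this)

/-! ### The framed Homfly polynomial -/

/-- `ℤ[l^{±1}, m^{±1}]`; the exponent `(i, j)` stands for `l ^ i * m ^ j`. -/
abbrev LaurentLM : Type := AddMonoidAlgebra ℤ (ℤ × ℤ)

namespace LaurentLM

noncomputable def l : LaurentLM := AddMonoidAlgebra.single (1, 0) 1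
noncomputable def lInv : LaurentLM := AddMonoidAlgebra.single (-1, 0) 1
noncomputable def m : LaurentLM := AddMonoidAlgebra.single (0, 1) 1
noncomputable def mInv : LaurentLM := AddMonoidAlgebra.single (0, -1) 1

end LaurentLM

/-- The defining properties of the Homfly polynomial of framed oriented links.  Every nonempty
framed oriented link is the closure of a braid with the blackboard framing; conjugate braids have
the same framed closure, a positive stabilization adds a positive kink to the closure, and these
moves relate any two braids with the same closure up to framing.  So the polynomial is a function
`P` of braids, `P n` on the braids with `n + 1` strands, which is invariant under conjugation, is
multiplied by `l` by a positive kink and by `(l - l⁻¹) / m` when a split unknot is added, satisfies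
the skein relation, and is `1` on the unknot with framing zero.  Exactly one function has these
properties. -/
structure IsFramedHomfly (P : ∀ n : ℕ, Braid n → LaurentLM) : Prop where
  conj : ∀ (n : ℕ) (α β : Braid n), P n (α * β) = P n (β * α)
  skein : ∀ (n : ℕ) (α β : Braid n) (i : Fin n),
    P n (α * Braid.σ i * β) - P n (α * (Braid.σ i)⁻¹ * β) = LaurentLM.m * P n (α * β)
  kink : ∀ (n : ℕ) (β : Braid n),
    P (n + 1) (Braid.addStrand n β * Braid.σ (Fin.last n)) = LaurentLM.l * P n β
  union_unknot : ∀ (n : ℕ) (β : Braid n),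
    P (n + 1) (Braid.addStrand n β) =
      (LaurentLM.l - LaurentLM.lInv) * LaurentLM.mInv * P n β
  unknot : P 0 1 = 1

/-- The power series `e^{c x}`. -/
noncomputable def expSeries {K : Type*} [Field K] [CharZero K] (c : K) : LaurentSeries K :=
  HahnSeries.ofPowerSeries ℤ K (PowerSeries.rescale c (PowerSeries.exp K))

/-- The substitution `l = e^{abx/2}`, `m = e^{ax/2} - e^{-ax/2}`, with values in Laurent series
in `x`. -/
noncomputable def LaurentLM.subst {K : Type*} [Field K] [CharZero K] (a b : K)
    (p : LaurentLM) : LaurentSeries K :=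
  p.coeff.sum fun e c =>
    (c : LaurentSeries K) * expSeries (a * b / 2) ^ e.1 *
      (expSeries (a / 2) - expSeries (-(a / 2))) ^ e.2

/-! ### Singular braids, singular string links and their chord diagrams -/

/-- Letters of a singular braid on `n + 1` strands: a positive crossing, a negative crossing, or a
double point carrying the name of a chord. -/
inductive SLetter (n k : ℕ) where
  | pos (i : Fin n)
  | neg (i : Fin n)
  | dbl (i : Fin n) (c : Fin k)

namespace SLetter

variable {n k : ℕ}

/-- The place of the crossing or double point. -/
def place : SLetter n k → Fin n
  | pos i => i
  | neg i => i
  | dbl i _ => i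

/-- Where the strand entering at place `p` leaves. -/
def move (s : SLetter n k) (p : Fin (n + 1)) : Fin (n + 1) :=
  Equiv.swap s.place.castSucc s.place.succ p

/-- The list of the (at most one) double points named by a letter. -/
def doublePoints : SLetter n k → List (Fin k)
  | pos _ => []
  | neg _ => []
  | dbl _ c => [c]

/-- The double points met by the strand entering at place `p`. -/
def encounters (s : SLetter n k) (p : Fin (n + 1)) : List (Fin k) :=
  if p = s.place.castSucc ∨ p = s.place.succ then s.doublePoints else []

/-- Where the strand entering a word (read from bottom to top) at place `p` leaves. -/
def moveWord : List (SLetter n k) → Fin (n + 1) → Fin (n + 1)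
  | [], p => p
  | s :: w, p => moveWord w (s.move p)

/-- The double points met, in order, by the strand entering a word at place `p`. -/
def encountersWord : List (SLetter n k) → Fin (n + 1) → List (Fin k)
  | [], _ => []
  | s :: w, p => s.encounters p ++ encountersWord w (s.move p)

/-- The extension of an invariant of braids to singular braids,
`v(double point) = v(positive crossing) - v(negative crossing)`; here `g` is the part of the braid
already resolved. -/
def extend {R : Type*} [Ring R] (v : Braid n → R) : Braid n → List (SLetter n k) → R
  | g, [] => v g
  | g, pos i :: w => extend v (g * Braid.σ i) w
  | g, neg i :: w => extend v (g * (Braid.σ i)⁻¹) w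
  | g, dbl i _ :: w => extend v (g * Braid.σ i) w - extend v (g * (Braid.σ i)⁻¹) w

end SLetter

/-- A singular string link with `m` strings and `k` named double points, presented as a partial
closure: the word is a singular braid on `n + 1` strands, the places from `m` on are closed up by
joining top and bottom, and the `j`-th string runs from bottom place `j` to top place `j` (so
`m ≤ n + 1`).  `route j` lists the bottom places through which the `j`-th string runs in turn;
every strand of the braid lies on exactly one string and is passed once, so there are no closed
components. The closure of the string link is the ordinary closure of the braid. -/
structure SingularStringLink (m k : ℕ) where
  n : ℕ
  word : List (SLetter n k)
  double_points : (word.flatMap SLetter.doublePoints).Perm (List.finRange k)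
  route : Fin m → List (Fin (n + 1))
  route_start : ∀ j : Fin m, (route j).head?.map Fin.val = some (j : ℕ)
  route_step : ∀ j : Fin m, (route j).IsChain fun p q => SLetter.moveWord word p = q
  route_end : ∀ j : Fin m,
    (route j).getLast?.map (fun p => (SLetter.moveWord word p : ℕ)) = some (j : ℕ)
  route_cover : ((List.ofFn route).flatten).Perm (List.finRange (n + 1))

/-- The chord diagram of the singular string link `L` is `D`: along each string, from bottom to
top, the double points of `L` are met in the order of the chord endpoints of `D`. -/
def SingularStringLink.HasChordDiagram {m k : ℕ} (L : SingularStringLink m k)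
    (D : ChordDiagram m k) : Prop :=
  ∀ j : Fin m, (L.route j).flatMap (SLetter.encountersWord L.word) = D.word j

/-- The power series in `x` of the closure of the singular string link `L`: the invariant `P`,
extended to singular links, after the substitution. -/
noncomputable def SingularStringLink.homflySeries {m k : ℕ} (L : SingularStringLink m k)
    (P : ∀ n : ℕ, Braid n → LaurentLM) {K : Type*} [Field K] [CharZero K] (a b : K) :
    LaurentSeries K :=
  LaurentLM.subst a b (SLetter.extend (P L.n) 1 L.word)

/-- `h` is the value `H(D)` of the Homfly regular weight system built from `P`: singular string
links with chord diagram `D` exist, and for each of them the coefficients of `x^j` with `j < k` of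
its series vanish while the coefficient of `x^k` is `h`. -/
def IsHomflyWeight (P : ∀ n : ℕ, Braid n → LaurentLM) {K : Type*} [Field K] [CharZero K]
    (a b : K) {m k : ℕ} (D : ChordDiagram m k) (h : K) : Prop :=
  (∃ L : SingularStringLink m k, L.HasChordDiagram D) ∧
  ∀ L : SingularStringLink m k, L.HasChordDiagram D →
    (∀ j : ℤ, j < k → (L.homflySeries P a b).coeff j = 0) ∧
    (L.homflySeries P a b).coeff k = h

/-! A double point is a difference of two crossings, so the skein relation turns it into `m` times
its smoothing (`SLetter.extend_eq`). The series of a singular link with `k` double points is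
therefore `m ^ k` times the series of an honest link, its smoothing. As `m = a x + ...`, only the
value of the latter at `x = 0` matters. There `m` vanishes, `l` is `1` and `(l - l⁻¹) / m` becomes
`b`: crossing changes and kinks are invisible, and a closure with `c` components has the value `b ^
(c - 1)` (`IsFramedHomfly.hasValue`).

It remains to find `c` for the smoothing. It is the dimension of the space of `ℤ/2`-colorings that
are constant on components. Seen along the original strings, such a coloring jumps by the same
amount `x v` at both endpoints of the chord `v`, namely by the difference of the two colors that
meet there. It is given by the initial colors `s 0`, `s 1` of the strings and the jumps `x`, subject
to linear equations that involve only the chord diagram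
(`SingularStringLink.finrank_singularColorings`). With `A` the adjacency matrix and `d` its
diagonal, these read `A x + (s 0 + s 1) d = 0` and `d ⬝ x = 0` (`ChordDiagram.mem_colorings_iff`).
Only `s 0 + s 1` enters, so `c - 1` is the dimension of the kernel of `A` bordered by `d`.

Since `A` is symmetric over `ℤ/2`, `d ⬝ x = x ⬝ A x`. Hence `d = A y` for some `y`, and `d ⬝ y` is
the parity of the rank `r` (`Matrix.IsSymm.diag_dotProduct_eq_rank`). Replacing `x` by `x + t y`,
with `t = s 0 + s 1`, identifies the bordered kernel with `ker A` for odd `r` and with `ker A × ℤ/2`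
for even `r`.

A string link with a given diagram is built from one braid strand for each arc of the diagram. -/

/-! ### The substitution and regular Laurent series -/

section Series

variable {K : Type*} [Field K]

/-- The Laurent series `z` has no pole, and its value at `0` is `v`. -/
def HasValue (z : LaurentSeries K) (v : K) : Prop :=
  ∃ φ : PowerSeries K, z = HahnSeries.ofPowerSeries ℤ K φ ∧ PowerSeries.constantCoeff φ = v

theorem HasValue.add {z w : LaurentSeries K} {u v : K} (hz : HasValue z u) (hw : HasValue w v) :
    HasValue (z + w) (u + v) := by
  obtain ⟨φ, rfl, rfl⟩ := hz
  obtain ⟨ψ, rfl, rfl⟩ := hw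
  exact ⟨φ + ψ, by simp, by simp⟩

theorem HasValue.mul {z w : LaurentSeries K} {u v : K} (hz : HasValue z u) (hw : HasValue w v) :
    HasValue (z * w) (u * v) := by
  obtain ⟨φ, rfl, rfl⟩ := hz
  obtain ⟨ψ, rfl, rfl⟩ := hw
  exact ⟨φ * ψ, by simp, by simp⟩

theorem HasValue.neg {z : LaurentSeries K} {u : K} (hz : HasValue z u) : HasValue (-z) (-u) := by
  obtain ⟨φ, rfl, rfl⟩ := hz
  exact ⟨-φ, by simp, by simp⟩

theorem HasValue.one : HasValue (1 : LaurentSeries K) 1 := ⟨1, by simp, by simp⟩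

theorem HasValue.ne_zero {z : LaurentSeries K} {u : K} (hz : HasValue z u) (hu : u ≠ 0) :
    z ≠ 0 := by
  rintro rfl
  obtain ⟨φ, h, rfl⟩ := hz
  have : φ = 0 := HahnSeries.ofPowerSeries_injective (by rw [← h, map_zero])
  simp [this] at hu

theorem HasValue.inv {z : LaurentSeries K} {u : K} (hz : HasValue z u) (hu : u ≠ 0) :
    HasValue z⁻¹ u⁻¹ := by
  have h0 := hz.ne_zero hu
  obtain ⟨φ, rfl, rfl⟩ := hz
  refine ⟨φ⁻¹, inv_eq_of_mul_eq_one_right ?_, by simp⟩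
  rw [← map_mul, PowerSeries.mul_inv_cancel _ hu, map_one]

theorem ofPowerSeries_X_ne_zero :
    HahnSeries.ofPowerSeries ℤ K PowerSeries.X ≠ 0 := by
  intro h
  exact PowerSeries.X_ne_zero (HahnSeries.ofPowerSeries_injective (by rw [h, map_zero]))

variable [CharZero K]

theorem hasValue_expSeries (c : K) : HasValue (expSeries c) 1 :=
  ⟨_, rfl, by simp [← PowerSeries.coeff_zero_eq_constantCoeff_apply]⟩

theorem expSeries_mul_neg (c : K) : expSeries c * expSeries (-c) = 1 := by
  rw [expSeries, expSeries, ← map_mul, PowerSeries.exp_mul_exp_eq_exp_add]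
  simp

/-- The power series `(e^{c x} - e^{-c x}) / x` has the value `2 c` at `0`. -/
theorem exists_expSeries_sub (c : K) : ∃ z : LaurentSeries K, HasValue z (2 * c) ∧
    expSeries c - expSeries (-c) = HahnSeries.ofPowerSeries ℤ K PowerSeries.X * z := by
  have h : (PowerSeries.X : PowerSeries K) ∣ PowerSeries.rescale c (PowerSeries.exp K) -
      PowerSeries.rescale (-c) (PowerSeries.exp K) := by
    rw [PowerSeries.X_dvd_iff, ← PowerSeries.coeff_zero_eq_constantCoeff_apply]
    simp [PowerSeries.coeff_rescale, -PowerSeries.coeff_zero_eq_constantCoeff]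
  obtain ⟨φ, hφ⟩ := h
  refine ⟨_, ⟨φ, rfl, ?_⟩, by rw [expSeries, expSeries, ← map_sub, hφ, map_mul]⟩
  -- The value of the quotient at `0` is the coefficient of `x` in the difference, `c - (-c)`.
  have := congrArg (PowerSeries.coeff 1) hφ
  rw [show 1 = 0 + 1 from rfl, PowerSeries.coeff_succ_X_mul] at this
  simp [PowerSeries.coeff_rescale, PowerSeries.coeff_exp] at this
  rw [← this]; ring

/-- The image of `m`. -/
noncomputable def mSeries (a : K) : LaurentSeries K := expSeries (a / 2) - expSeries (-(a / 2))

theorem exists_mSeries (a : K) : ∃ z : LaurentSeries K, HasValue z a ∧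
    mSeries a = HahnSeries.ofPowerSeries ℤ K PowerSeries.X * z := by
  obtain ⟨z, hz, h⟩ := exists_expSeries_sub (a / 2)
  exact ⟨z, by rwa [mul_div_cancel₀ _ two_ne_zero] at hz, h⟩

theorem mSeries_ne_zero {a : K} (ha : a ≠ 0) : mSeries a ≠ 0 := by
  obtain ⟨z, hz, h⟩ := exists_mSeries a
  rw [h]
  exact mul_ne_zero ofPowerSeries_X_ne_zero (hz.ne_zero ha)

/-- This vanishing makes crossing changes invisible at `x = 0`. -/
theorem hasValue_mSeries (a : K) : HasValue (mSeries a) 0 := by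
  simpa [mSeries, sub_eq_add_neg] using
    (hasValue_expSeries (a / 2)).add (hasValue_expSeries (-(a / 2))).neg

/-- Adding a split unknot multiplies the value at `0` by `b`. -/
theorem hasValue_unknot_factor {a : K} (ha : a ≠ 0) (b : K) :
    HasValue ((expSeries (a * b / 2) - (expSeries (a * b / 2))⁻¹) * (mSeries a)⁻¹) b := by
  obtain ⟨z, hz, h⟩ := exists_mSeries a
  obtain ⟨w, hw, h'⟩ := exists_expSeries_sub (a * b / 2)
  rw [inv_eq_of_mul_eq_one_right (expSeries_mul_neg _), h', h]
  have : HahnSeries.ofPowerSeries ℤ K PowerSeries.X * w *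
      (HahnSeries.ofPowerSeries ℤ K PowerSeries.X * z)⁻¹ = w * z⁻¹ := by
    rw [mul_inv]
    field_simp [ofPowerSeries_X_ne_zero]
  rw [this]
  convert hw.mul (hz.inv ha) using 1
  field_simp

/-- Multiplication by `m ^ k` shifts the value at `0` to the coefficient at `k`. -/
theorem coeff_mSeries_pow_mul (a : K) (k : ℕ) {z : LaurentSeries K} {v : K} (hz : HasValue z v) :
    (∀ j : ℤ, j < k → (mSeries a ^ k * z).coeff j = 0) ∧
      (mSeries a ^ k * z).coeff k = a ^ k * v := by
  obtain ⟨y, hy, h⟩ := exists_mSeries a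
  have hp : HasValue (y ^ k) (a ^ k) := by
    induction k with
    | zero => simpa using HasValue.one
    | succ k ih => rw [pow_succ, pow_succ]; exact ih.mul hy
  obtain ⟨φ, hφ, hv⟩ := hp.mul hz
  have key : mSeries a ^ k * z = HahnSeries.ofPowerSeries ℤ K (PowerSeries.X ^ k * φ) := by
    rw [h, mul_pow, mul_assoc, hφ, map_mul, map_pow]
  rw [key]
  constructor
  · intro j hj
    rcases lt_or_ge j 0 with h0 | h0
    · rw [HahnSeries.ofPowerSeries_apply]
      apply HahnSeries.embDomain_of_notMem_range
      rintro ⟨n, hn⟩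
      simp at hn
      omega
    · lift j to ℕ using h0
      rw [LaurentSeries.coeff_coe_powerSeries, PowerSeries.coeff_X_pow_mul', if_neg (by omega)]
  · rw [LaurentSeries.coeff_coe_powerSeries, PowerSeries.coeff_X_pow_mul', if_pos le_rfl,
      Nat.sub_self, PowerSeries.coeff_zero_eq_constantCoeff_apply, hv]

/-- The substitution as a homomorphism of rings. -/
noncomputable def substHom (a b : K) (ha : a ≠ 0) : LaurentLM →+* LaurentSeries K :=
  (AddMonoidAlgebra.lift ℤ (LaurentSeries K) (ℤ × ℤ)
    { toFun := fun e => expSeries (a * b / 2) ^ e.toAdd.1 * mSeries a ^ e.toAdd.2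
      map_one' := by simp
      map_mul' := fun e e' => by
        -- Integer exponents add only over nonzero bases; for `m` this needs `a ≠ 0`.
        have h1 := (hasValue_expSeries (a * b / 2)).ne_zero one_ne_zero
        have h2 := mSeries_ne_zero ha
        simp only [toAdd_mul, Prod.fst_add, Prod.snd_add, zpow_add₀ h1, zpow_add₀ h2]
        ring }).toRingHom

theorem substHom_apply (a b : K) (ha : a ≠ 0) (p : LaurentLM) :
    substHom a b ha p = LaurentLM.subst a b p := by
  simp only [substHom, LaurentLM.subst, AlgHom.toRingHom_eq_coe, RingHom.coe_coe,
    AddMonoidAlgebra.lift_apply', MonoidHom.coe_mk, OneHom.coe_mk, eq_intCast, mul_assoc]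
  rfl

theorem subst_single (a b : K) (i j : ℤ) :
    LaurentLM.subst a b (AddMonoidAlgebra.single (i, j) 1) =
      expSeries (a * b / 2) ^ i * mSeries a ^ j := by
  simp [LaurentLM.subst, mSeries]

end Series

/-! ### Reduction of braids by skein moves -/

section Reduction

variable {G : Type*} [Group G]

/-- The subgroup generated by the first `n` generators. -/
def initialSubgroup (σ : ℕ → G) (n : ℕ) : Subgroup G := Subgroup.closure {g | ∃ i < n, g = σ i}

theorem initialSubgroup_le_succ (σ : ℕ → G) (n : ℕ) :
    initialSubgroup σ n ≤ initialSubgroup σ (n + 1) :=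
  Subgroup.closure_mono fun _ ⟨i, hi, h⟩ => ⟨i, by omega, h⟩

theorem mem_initialSubgroup (σ : ℕ → G) {n i : ℕ} (h : i < n) : σ i ∈ initialSubgroup σ n :=
  Subgroup.subset_closure ⟨i, h, rfl⟩

/-- The property `Q` is stable under skein moves at the generator `s`. -/
def SkeinStable (Q : G → Prop) (s : G) : Prop :=
  ∀ α β, Q (α * β) → (Q (α * s * β) ↔ Q (α * s⁻¹ * β))

theorem SkeinStable.translate {Q : G → Prop} {s : G} (h : SkeinStable Q s) (u v : G) :
    SkeinStable (fun x => Q (u * x * v)) s := fun α β hαβ => by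
  have := h (u * α) (β * v)
  simp only [mul_assoc] at this hαβ ⊢
  exact this hαβ

/-- Apply stability to one of the two factors `s`: its smoothing leaves a single `s`, and its
inverse cancels the other one. -/
theorem SkeinStable.sq {Q : G → Prop} {s : G} (h : SkeinStable Q s) (α β : G) (h0 : Q (α * β))
    (h1 : Q (α * s * β)) : Q (α * s * (s * β)) := by
  have := h α (s * β)
  simp only [mul_assoc, inv_mul_cancel_left] at this h0 h1 ⊢
  exact (this h1).2 h0

/-- Products of elements of `H` and `t` with `j` factors `t`. -/
inductive ProductWith (H : Subgroup G) (t : G) : ℕ → G → Prop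
  | base {h : G} (hh : h ∈ H) : ProductWith H t 0 h
  | step {h e : G} {j : ℕ} (hh : h ∈ H) (he : ProductWith H t j e) :
      ProductWith H t (j + 1) (h * t * e)

namespace ProductWith

variable {H : Subgroup G} {t : G}

theorem left_mul {j : ℕ} {e h : G} (hh : h ∈ H) (he : ProductWith H t j e) :
    ProductWith H t j (h * e) := by
  cases he with
  | base hh' => exact .base (mul_mem hh hh')
  | step hh' he' => simpa [mul_assoc] using ProductWith.step (mul_mem hh hh') he'

theorem mul_right {j : ℕ} {e h : G} (hh : h ∈ H) (he : ProductWith H t j e) :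
    ProductWith H t j (e * h) := by
  induction he with
  | base hh' => exact .base (mul_mem hh' hh)
  | step hh' _ ih => simpa [mul_assoc] using ProductWith.step hh' ih

theorem mul_gen {j : ℕ} {e : G} (he : ProductWith H t j e) :
    ProductWith H t (j + 1) (e * t) := by
  induction he with
  | base hh' => simpa using ProductWith.step hh' (.base H.one_mem)
  | step hh' _ ih => simpa [mul_assoc] using ProductWith.step hh' ih

end ProductWith

variable (σ : ℕ → G) {N : ℕ}

theorem commute_of_mem_initialSubgroup
    (hcomm : ∀ i j, i + 1 < j → j < N → σ i * σ j = σ j * σ i)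
    {n : ℕ} (hn : n + 1 < N) {x : G} (hx : x ∈ initialSubgroup σ n) :
    σ (n + 1) * x = x * σ (n + 1) := by
  have : initialSubgroup σ n ≤ Subgroup.centralizer {σ (n + 1)} := by
    rw [initialSubgroup, Subgroup.closure_le]
    rintro _ ⟨i, hi, rfl⟩
    simpa [Subgroup.mem_centralizer_iff] using (hcomm i (n + 1) (by omega) hn).symm
  exact Subgroup.mem_centralizer_iff.1 (this hx) _ rfl

/-- Inverse crossings at the last place can be traded for positive ones: reading from the left with
a positive prefix `u`, the smoothing and the positive version are both covered by the induction on
the remaining word. -/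
theorem of_productWith {Q : G → Prop} {n : ℕ} (hQ : SkeinStable Q (σ n))
    (h : ∀ j e, ProductWith (initialSubgroup σ n) (σ n) j e → Q e) :
    ∀ α ∈ initialSubgroup σ (n + 1), Q α := by
  suffices H : ∀ α ∈ initialSubgroup σ (n + 1), ∀ j u,
      ProductWith (initialSubgroup σ n) (σ n) j u → Q (u * α) by
    intro α hα
    simpa using H α hα 0 1 (.base (one_mem _))
  intro α hα
  refine Subgroup.closure_induction_left
    (p := fun x _ => ∀ j u, ProductWith (initialSubgroup σ n) (σ n) j u → Q (u * x))
    ?_ ?_ ?_ hα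
  · intro j u hu
    simpa using h j u hu
  · rintro _ ⟨i, hi, rfl⟩ y _ ih j u hu
    rw [← mul_assoc]
    rcases Nat.lt_succ_iff_lt_or_eq.1 hi with hi | rfl
    · exact ih _ _ (hu.mul_right (mem_initialSubgroup σ hi))
    · exact ih _ _ hu.mul_gen
  · rintro _ ⟨i, hi, rfl⟩ y _ ih j u hu
    rw [← mul_assoc]
    rcases Nat.lt_succ_iff_lt_or_eq.1 hi with hi | rfl
    · exact ih _ _ (hu.mul_right (inv_mem (mem_initialSubgroup σ hi)))
    · exact (hQ u y (ih _ _ hu)).1 (ih _ _ hu.mul_gen)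

/-- Strong induction on the number of factors `t`: only products with at least two need work, and
there all shorter products may be assumed. -/
theorem productWith_induction {H : Subgroup G} {t : G} {Q : G → Prop}
    (h0 : ∀ α ∈ H, Q α) (h1 : ∀ α ∈ H, ∀ β ∈ H, Q (α * t * β))
    (h2 : ∀ j, (∀ i ≤ j + 1, ∀ e, ProductWith H t i e → Q e) → ∀ α ∈ H, ∀ β ∈ H, ∀ e,
      ProductWith H t j e → Q (α * t * β * (t * e))) :
    ∀ j e, ProductWith H t j e → Q e := by
  intro j
  induction j using Nat.strong_induction_on with
  | _ j ih =>
    intro e he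
    cases he with
    | base hh => exact h0 _ hh
    | step hh he =>
      cases he with
      | base hh' => exact h1 _ hh _ hh'
      | step hh' he' =>
        have := h2 _ (fun i hi => ih i (by omega)) _ hh _ hh' _ he'
        simpa [mul_assoc] using this

/-- Modulo skein moves, every braid has at most one crossing at the last place. -/
theorem of_skeinStable
    (hcomm : ∀ i j, i + 1 < j → j < N → σ i * σ j = σ j * σ i)
    (hbraid : ∀ i, i + 1 < N → σ i * σ (i + 1) * σ i = σ (i + 1) * σ i * σ (i + 1))
    (n : ℕ) (hn : n < N) (Q : G → Prop) (hQ : ∀ i ≤ n, SkeinStable Q (σ i))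
    (h0 : ∀ α ∈ initialSubgroup σ n, Q α)
    (h1 : ∀ α ∈ initialSubgroup σ n, ∀ β ∈ initialSubgroup σ n, Q (α * σ n * β)) :
    ∀ α ∈ initialSubgroup σ (n + 1), Q α := by
  induction n generalizing Q with
  | zero =>
    have hbot : ∀ x ∈ initialSubgroup σ 0, x = 1 := by
      intro x hx
      have : {g | ∃ i < 0, g = σ i} = ∅ := by ext; simp
      rwa [initialSubgroup, this, Subgroup.closure_empty, Subgroup.mem_bot] at hx
    refine of_productWith σ (hQ 0 le_rfl) (productWith_induction h0 h1 ?_)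
    intro j hj α hα β hβ e he
    -- Nothing separates the two crossings, so they form a square.
    rw [hbot β hβ, mul_one]
    exact (hQ 0 le_rfl).sq α e (hj j (by omega) _ (he.left_mul hα))
      (hj _ le_rfl _ (.step hα he))
  | succ n ih =>
    refine of_productWith σ (hQ _ le_rfl) (productWith_induction h0 h1 ?_)
    intro j hj α hα β hβ e he
    -- The factor between two crossings at the last place lies in the smaller subgroup, so by
    -- induction it may be taken to have at most one crossing at its own last place.
    refine ih (by omega) (fun x => Q (α * σ (n + 1) * x * (σ (n + 1) * e)))
      (fun i hi => (hQ i (by omega)).translate _ _) ?_ ?_ β hβ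
    · intro x hx
      -- No such crossing: `x` commutes with `σ (n + 1)`, and the two outer crossings become a
      -- square.
      have hc := commute_of_mem_initialSubgroup σ hcomm hn hx
      have hx' := initialSubgroup_le_succ σ n hx
      have := (hQ _ le_rfl).sq (α * x) e (hj j (by omega) _ (he.left_mul (mul_mem hα hx')))
        (hj _ le_rfl _ (.step (mul_mem hα hx') he))
      rw [mul_assoc α x, ← hc] at this
      simpa only [mul_assoc] using this
    · intro x hx y hy
      have hcx := commute_of_mem_initialSubgroup σ hcomm hn hx
      have hcy := commute_of_mem_initialSubgroup σ hcomm hn hy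
      have hx' := initialSubgroup_le_succ σ n hx
      have hy' := initialSubgroup_le_succ σ n hy
      have hs := mem_initialSubgroup σ (Nat.lt_succ_self n)
      -- One such crossing: the braid relation replaces two crossings at the last place by one.
      have := hj _ le_rfl _ (.step (mul_mem (mul_mem hα hx') hs)
        (he.left_mul (mul_mem hs hy')))
      have heq : α * σ (n + 1) * (x * σ n * y) * (σ (n + 1) * e) =
          α * x * σ n * σ (n + 1) * (σ n * y * e) := by
        calc _ = α * (σ (n + 1) * x) * σ n * (y * σ (n + 1)) * e := by simp only [mul_assoc]
          _ = α * x * (σ (n + 1) * σ n * σ (n + 1)) * y * e := by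
            rw [hcx, ← hcy]; simp only [mul_assoc]
          _ = _ := by rw [← hbraid n hn]; simp only [mul_assoc]
      rwa [heq]

end Reduction

/-! ### Permutations of braids -/

section FixedColorings

variable {X : Type*}

/-- The colorings by `ℤ/2` which are invariant under `π`; their dimension is the number of cycles
if `π` is a permutation of a finite set. -/
def invariantColorings (π : X → X) : Submodule (ZMod 2) (X → ZMod 2) where
  carrier := {f | ∀ p, f (π p) = f p}
  add_mem' := fun hf hg p => by simp [hf p, hg p]
  zero_mem' := fun _ => rfl
  smul_mem' := fun c f hf p => by simp [hf p]

/-- The number of cycles. -/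
noncomputable def numCycles (π : X → X) : ℕ :=
  Module.finrank (ZMod 2) (invariantColorings π)

/-- Pulling back along `π` and along `ρ` are mutually inverse on invariant colorings; bijectivity is
not needed. -/
theorem numCycles_comp_comm (π ρ : X → X) : numCycles (π ∘ ρ) = numCycles (ρ ∘ π) := by
  refine LinearEquiv.finrank_eq
    { toFun := fun f => ⟨fun p => f.1 (π p), fun p => f.2 (π p)⟩
      invFun := fun f => ⟨fun p => f.1 (ρ p), fun p => f.2 (ρ p)⟩
      map_add' := fun _ _ => rfl
      map_smul' := fun _ _ => rfl
      left_inv := fun f => Subtype.ext (funext fun p => f.2 p)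
      right_inv := fun f => Subtype.ext (funext fun p => f.2 p) }

theorem numCycles_of_inverse {π ρ : X → X} (h : ∀ p, π (ρ p) = p) (h' : ∀ p, ρ (π p) = p) :
    numCycles π = numCycles ρ := by
  have : invariantColorings π = invariantColorings ρ := by
    ext f
    refine ⟨fun hf p => ?_, fun hf p => ?_⟩
    · rw [← hf (ρ p), h]
    · rw [← hf (π p), h']
  rw [numCycles, this, numCycles]

theorem numCycles_fin_one (π : Fin 1 → Fin 1) : numCycles π = 1 := by
  have : invariantColorings π = ⊤ := by
    ext f
    simp only [Submodule.mem_top, iff_true]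
    exact fun p => by rw [Subsingleton.elim (π p) p]
  rw [numCycles, this, finrank_top]
  simp

/-- The new fixed point carries a free color. This is the split unknot. -/
theorem numCycles_addFixed {n : ℕ} {π : Fin n → Fin n} {ρ : Fin (n + 1) → Fin (n + 1)}
    (h : ∀ p, ρ p.castSucc = (π p).castSucc) (h' : ρ (Fin.last n) = Fin.last n) :
    numCycles ρ = numCycles π + 1 := by
  have e : invariantColorings ρ ≃ₗ[ZMod 2] invariantColorings π × ZMod 2 :=
    { toFun := fun f => (⟨fun p => f.1 p.castSucc, fun p => by
        simpa only [h] using f.2 p.castSucc⟩, f.1 (Fin.last n))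
      invFun := fun f => ⟨Fin.lastCases f.2 f.1.1, fun p => by
        induction p using Fin.lastCases with
        | last => rw [h']
        | cast p => rw [h]; simpa using f.1.2 p⟩
      map_add' := fun _ _ => rfl
      map_smul' := fun _ _ => rfl
      left_inv := fun f => Subtype.ext (funext fun p => by
        induction p using Fin.lastCases <;> simp)
      right_inv := fun f => by ext <;> simp }
  rw [numCycles, e.finrank_eq, Module.finrank_prod, Module.finrank_self, numCycles]

/-- The transposition inserts the new point into the cycle of the last old one, so its color is
forced. This is the kink. -/
theorem numCycles_stabilize {n : ℕ} {π : Fin (n + 1) → Fin (n + 1)}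
    {ρ : Fin (n + 2) → Fin (n + 2)}
    (h : ∀ p, ρ p.castSucc = (π p).castSucc) (h' : ρ (Fin.last _) = Fin.last _) :
    numCycles (ρ ∘ Equiv.swap (Fin.last n).castSucc (Fin.last n).succ) = numCycles π := by
  have hs : (Fin.last n).succ = Fin.last (n + 1) := rfl
  have hl : ∀ f ∈ invariantColorings (ρ ∘ Equiv.swap (Fin.last n).castSucc (Fin.last n).succ),
      f (Fin.last (n + 1)) = f (Fin.last n).castSucc := by
    intro f hf
    have := hf (Fin.last n).castSucc
    simpa [hs, h'] using this
  refine LinearEquiv.finrank_eq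
    { toFun := fun f => ⟨fun p => f.1 p.castSucc, fun p => ?_⟩
      invFun := fun f => ⟨Fin.lastCases (f.1 (Fin.last n)) f.1, fun p => ?_⟩
      map_add' := fun _ _ => rfl
      map_smul' := fun _ _ => rfl
      left_inv := fun f => Subtype.ext (funext fun p => by
        induction p using Fin.lastCases with
        | last => simpa using (hl f.1 f.2).symm
        | cast p => simp)
      right_inv := fun f => by ext; simp }
  · change f.1 (π p).castSucc = f.1 p.castSucc
    rw [← h]
    rcases eq_or_ne p (Fin.last n) with rfl | hp
    · have := f.2 (Fin.last (n + 1))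
      rw [hl f.1 f.2] at this
      simpa [hs] using this
    · have := f.2 p.castSucc
      rw [Function.comp_apply, Equiv.swap_apply_of_ne_of_ne (by simpa using hp)
        (by rw [hs]; exact Fin.castSucc_ne_last p)] at this
      exact this
  · induction p using Fin.lastCases with
    | last => simpa [hs, h] using f.2 (Fin.last n)
    | cast p =>
      rcases eq_or_ne p (Fin.last n) with rfl | hp
      · simp [hs, h']
      · rw [Function.comp_apply, Equiv.swap_apply_of_ne_of_ne (by simpa using hp)
          (by rw [hs]; exact Fin.castSucc_ne_last p), h]
        simpa using f.2 p

end FixedColorings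

section BraidPermutation

namespace Braid

/-- The permutation of a braid. -/
noncomputable def perm (n : ℕ) : Braid n →* Equiv.Perm (Fin (n + 1)) :=
  PresentedGroup.toGroup (f := fun i : Fin n => Equiv.swap i.castSucc i.succ) (by
    rintro r (⟨i, j, hij, rfl⟩ | ⟨i, j, hij, rfl⟩)
    · simp only [map_mul, map_inv, FreeGroup.lift_apply_of, mul_inv_eq_one]
      have h1 : i.castSucc ≠ j.castSucc := by simp [Fin.ext_iff]; omega
      have h2 : i.castSucc ≠ j.succ := by simp [Fin.ext_iff]; omega
      have h3 : i.succ ≠ j.castSucc := by simp [Fin.ext_iff]; omega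
      have h4 : i.succ ≠ j.succ := by simp [Fin.ext_iff]; omega
      refine (Equiv.Perm.Disjoint.commute fun x => ?_)
      by_cases hx : x = i.castSucc ∨ x = i.succ
      · right
        rcases hx with rfl | rfl
        · exact Equiv.swap_apply_of_ne_of_ne h1 h2
        · exact Equiv.swap_apply_of_ne_of_ne h3 h4
      · left
        push Not at hx
        exact Equiv.swap_apply_of_ne_of_ne hx.1 hx.2
    · simp only [map_mul, map_inv, FreeGroup.lift_apply_of, mul_inv_eq_one]
      have h : j.castSucc = i.succ := by simp [Fin.ext_iff]; omega
      have h1 : i.castSucc ≠ i.succ := by simp [Fin.ext_iff]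
      have h2 : i.castSucc ≠ j.succ := by simp [Fin.ext_iff]; omega
      have h3 : i.succ ≠ j.succ := by simp [Fin.ext_iff]; omega
      -- Both sides of the braid relation are the transposition of the outer two of the three
      -- places.
      rw [h, Equiv.swap_mul_swap_mul_swap h1 h2, Equiv.swap_comm i.succ, Equiv.swap_comm i.castSucc,
        Equiv.swap_mul_swap_mul_swap h3.symm h2.symm, Equiv.swap_comm])

@[simp]
theorem perm_σ {n : ℕ} (i : Fin n) : perm n (σ i) = Equiv.swap i.castSucc i.succ :=
  PresentedGroup.toGroup.of _

@[simp]
theorem addStrand_σ {n : ℕ} (i : Fin n) : addStrand n (σ i) = σ i.castSucc :=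
  PresentedGroup.toGroup.of _

theorem closure_range_σ (n : ℕ) : Subgroup.closure (Set.range (σ : Fin n → Braid n)) = ⊤ :=
  PresentedGroup.closure_range_of _

theorem perm_addStrand {n : ℕ} (β : Braid n) :
    (∀ p, perm (n + 1) (addStrand n β) p.castSucc = (perm n β p).castSucc) ∧
      perm (n + 1) (addStrand n β) (Fin.last _) = Fin.last _ := by
  have hσ : ∀ i : Fin n, (∀ p : Fin (n + 1),
      Equiv.swap i.castSucc.castSucc i.castSucc.succ p.castSucc =
        (Equiv.swap i.castSucc i.succ p).castSucc) ∧
      Equiv.swap i.castSucc.castSucc i.castSucc.succ (Fin.last (n + 1)) = Fin.last _ := by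
    intro i
    refine ⟨fun p => ?_, ?_⟩
    · rw [Fin.succ_castSucc]
      exact ((Fin.castSucc_injective (n + 1)).swap_apply i.castSucc i.succ p)
    · rw [Fin.succ_castSucc]
      exact Equiv.swap_apply_of_ne_of_ne (Fin.castSucc_ne_last _).symm
        (Fin.castSucc_ne_last _).symm
  have hmem : β ∈ Subgroup.closure (Set.range (σ : Fin n → Braid n)) := by
    rw [closure_range_σ]; trivial
  induction hmem using Subgroup.closure_induction with
  | mem x hx =>
    obtain ⟨i, rfl⟩ := hx
    simpa using hσ i
  | one => simp
  | mul x y _ _ hx hy => simp [hx.1, hx.2, hy.1, hy.2]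
  | inv x _ hx =>
    rw [map_inv, map_inv, map_inv]
    refine ⟨fun p => ?_, ?_⟩
    · rw [Equiv.Perm.inv_eq_iff_eq, hx.1]; simp
    · rw [Equiv.Perm.inv_eq_iff_eq, hx.2]

/-- The standard generators indexed by natural numbers. -/
noncomputable def generator (n i : ℕ) : Braid n := if h : i < n then σ ⟨i, h⟩ else 1

theorem generator_of_lt {n i : ℕ} (h : i < n) : generator n i = σ ⟨i, h⟩ := dif_pos h

theorem generator_comm (n i j : ℕ) (h : i + 1 < j) (hj : j < n) :
    generator n i * generator n j = generator n j * generator n i := by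
  rw [generator_of_lt hj, generator_of_lt (show i < n by omega)]
  have := PresentedGroup.mk_eq_mk_of_mul_inv_mem
    (show _ ∈ braidRels n from Or.inl ⟨⟨i, by omega⟩, ⟨j, hj⟩, h, rfl⟩)
  rwa [map_mul, map_mul] at this

theorem generator_braid (n i : ℕ) (h : i + 1 < n) :
    generator n i * generator n (i + 1) * generator n i =
      generator n (i + 1) * generator n i * generator n (i + 1) := by
  rw [generator_of_lt h, generator_of_lt (show i < n by omega)]
  have := PresentedGroup.mk_eq_mk_of_mul_inv_mem
    (show _ ∈ braidRels n from Or.inr ⟨⟨i, by omega⟩, ⟨i + 1, h⟩, rfl, rfl⟩)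
  rwa [map_mul, map_mul, map_mul, map_mul] at this

theorem initialSubgroup_le_range (n : ℕ) :
    initialSubgroup (generator (n + 1)) n ≤ (addStrand n).range := by
  rw [initialSubgroup, Subgroup.closure_le]
  rintro _ ⟨i, hi, rfl⟩
  exact ⟨σ ⟨i, hi⟩, by rw [addStrand_σ, generator_of_lt (by omega)]; rfl⟩

theorem initialSubgroup_eq_top (n : ℕ) : initialSubgroup (generator n) n = ⊤ := by
  rw [eq_top_iff, ← closure_range_σ, Subgroup.closure_le]
  rintro _ ⟨i, rfl⟩
  rw [← generator_of_lt i.2]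
  exact mem_initialSubgroup _ i.2

/-- Skein moves reduce every braid to the closures covered by the Markov moves. -/
theorem induction_skein {n : ℕ} {Q : Braid (n + 1) → Prop} (hQ : ∀ i, SkeinStable Q (σ i))
    (h0 : ∀ α, Q (addStrand n α))
    (h1 : ∀ α β, Q (addStrand n α * σ (Fin.last n) * addStrand n β)) (α : Braid (n + 1)) :
    Q α := by
  refine of_skeinStable (generator (n + 1)) (generator_comm (n + 1)) (generator_braid (n + 1)) n
    (Nat.lt_succ_self n) Q (fun i hi => ?_) (fun α hα => ?_) (fun α hα β hβ => ?_) α ?_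
  · rw [generator_of_lt (by omega)]
    exact hQ _
  · obtain ⟨x, rfl⟩ := initialSubgroup_le_range n hα
    exact h0 x
  · obtain ⟨x, rfl⟩ := initialSubgroup_le_range n hα
    obtain ⟨y, rfl⟩ := initialSubgroup_le_range n hβ
    rw [generator_of_lt (Nat.lt_succ_self n)]
    exact h1 x y
  · rw [initialSubgroup_eq_top]; trivial

end Braid

end BraidPermutation

/-! ### The Homfly polynomial of a braid at `x = 0` -/

/-- The constant coloring `1` is nonzero. Hence the exponent `numCycles - 1` is a genuine
difference. -/
theorem numCycles_pos {n : ℕ} (π : Fin (n + 1) → Fin (n + 1)) : 0 < numCycles π := by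
  rw [numCycles, Module.finrank_pos_iff]
  refine ⟨⟨0, ⟨fun _ => 1, fun _ => rfl⟩, fun h => ?_⟩⟩
  exact zero_ne_one (congrFun (congrArg Subtype.val h) 0)

/-- The series of the closure of a braid has no pole, and its value at `x = 0` is `b ^ (c - 1)` for
a closure with `c` components. -/
theorem IsFramedHomfly.hasValue {P : ∀ n : ℕ, Braid n → LaurentLM} (hP : IsFramedHomfly P)
    {K : Type*} [Field K] [CharZero K] {a : K} (ha : a ≠ 0) (b : K) (n : ℕ) (β : Braid n) :
    HasValue (LaurentLM.subst a b (P n β)) (b ^ (numCycles (Braid.perm n β) - 1)) := by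
  simp only [← substHom_apply a b ha]
  have hl : substHom a b ha LaurentLM.l = expSeries (a * b / 2) := by
    rw [substHom_apply, LaurentLM.l, subst_single]; simp
  have hlInv : substHom a b ha LaurentLM.lInv = (expSeries (a * b / 2))⁻¹ := by
    rw [substHom_apply, LaurentLM.lInv, subst_single]; simp
  have hm : substHom a b ha LaurentLM.m = mSeries a := by
    rw [substHom_apply, LaurentLM.m, subst_single]; simp
  have hmInv : substHom a b ha LaurentLM.mInv = (mSeries a)⁻¹ := by
    rw [substHom_apply, LaurentLM.mInv, subst_single]; simp
  induction n with
  | zero =>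
    have hβ : β = 1 := by
      have : β ∈ Subgroup.closure (Set.range (Braid.σ : Fin 0 → Braid 0)) := by
        rw [Braid.closure_range_σ]; trivial
      simpa using this
    rw [hβ, hP.unknot, numCycles_fin_one, map_one]
    simpa using HasValue.one
  | succ n ih =>
    refine Braid.induction_skein (Q := fun β => HasValue (substHom a b ha (P (n + 1) β))
      (b ^ (numCycles (Braid.perm (n + 1) β) - 1))) ?_ ?_ ?_ β
    · intro i α β h
      have hs := congrArg (substHom a b ha) (hP.skein (n + 1) α β i)
      rw [map_sub, map_mul, hm, sub_eq_iff_eq_add] at hs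
      -- The smoothing has no pole, so `m` times it vanishes at `0`, whatever its number of
      -- components.
      have hmz := (hasValue_mSeries a).mul h
      rw [zero_mul] at hmz
      have hp : Braid.perm (n + 1) (α * (Braid.σ i)⁻¹ * β) =
          Braid.perm (n + 1) (α * Braid.σ i * β) := by simp
      dsimp only
      rw [hp, hs]
      refine ⟨fun h' => ?_, fun h' => by simpa using hmz.add h'⟩
      have := hmz.neg.add h'
      simpa using this
    · intro α
      obtain ⟨h, h'⟩ := Braid.perm_addStrand α
      rw [hP.union_unknot, numCycles_addFixed h h', map_mul, map_mul, map_sub, hl, hlInv, hmInv]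
      have := (hasValue_unknot_factor ha b).mul (ih α)
      rwa [← pow_succ', Nat.sub_add_cancel (numCycles_pos _), ← Nat.add_sub_cancel
        (n := numCycles (Braid.perm n α)) (m := 1)] at this
    · intro α β
      obtain ⟨h, h'⟩ := Braid.perm_addStrand (β * α)
      -- After conjugation the braid is the positive stabilization of `β * α`.
      have hc : numCycles (Braid.perm (n + 1) (Braid.addStrand n α * Braid.σ (Fin.last n) *
          Braid.addStrand n β)) = numCycles (Braid.perm n (β * α)) := by
        rw [← numCycles_stabilize h h', map_mul, Equiv.Perm.coe_mul, numCycles_comp_comm,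
          ← Equiv.Perm.coe_mul, ← map_mul, ← mul_assoc, ← map_mul, map_mul, Braid.perm_σ]
        rfl
      rw [hc, hP.conj, ← mul_assoc, ← map_mul, hP.kink, map_mul, hl]
      simpa using (hasValue_expSeries (a * b / 2)).mul (ih (β * α))

/-! ### Smoothing the double points -/

namespace SLetter

variable {n k : ℕ}

/-- The letter as a braid, with double points smoothed. -/
noncomputable def smoothing : SLetter n k → Braid n
  | pos i => Braid.σ i
  | neg i => (Braid.σ i)⁻¹
  | dbl _ _ => 1

/-- The braid obtained from a singular braid by smoothing the double points. -/
noncomputable def smoothedBraid (w : List (SLetter n k)) : Braid n := (w.map smoothing).prod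

/-- Each double point contributes the two sides of one skein triple, hence a factor `m` and its
smoothing. -/
theorem extend_eq {v : Braid n → LaurentLM}
    (hv : ∀ (α β : Braid n) (i : Fin n), v (α * Braid.σ i * β) - v (α * (Braid.σ i)⁻¹ * β) =
      LaurentLM.m * v (α * β)) (w : List (SLetter n k)) (g : Braid n) :
    extend v g w = LaurentLM.m ^ (w.flatMap doublePoints).length * v (g * smoothedBraid w) := by
  induction w generalizing g with
  | nil => simp [extend, smoothedBraid]
  | cons s w ih =>
    cases s with
    | pos i => simp [extend, ih, smoothedBraid, smoothing, doublePoints, mul_assoc]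
    | neg i => simp [extend, ih, smoothedBraid, smoothing, doublePoints, mul_assoc]
    | dbl i c =>
      rw [extend, ih, ih, ← mul_sub, hv]
      simp [smoothedBraid, smoothing, doublePoints, pow_succ, mul_assoc]

/-- Where the strand entering at place `p` leaves after smoothing. -/
def smoothMove : SLetter n k → Fin (n + 1) → Fin (n + 1)
  | dbl _ _ => id
  | s => s.move

theorem move_move (s : SLetter n k) (p : Fin (n + 1)) : s.move (s.move p) = p := by
  simp [move]

theorem smoothMove_smoothMove (s : SLetter n k) (p : Fin (n + 1)) :
    s.smoothMove (s.smoothMove p) = p := by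
  cases s <;> simp [smoothMove, move]

/-- Where the strand entering a word at place `p` leaves after smoothing. -/
def smoothMoveWord : List (SLetter n k) → Fin (n + 1) → Fin (n + 1)
  | [], p => p
  | s :: w, p => smoothMoveWord w (s.smoothMove p)

theorem perm_smoothing (s : SLetter n k) (p : Fin (n + 1)) :
    Braid.perm n s.smoothing p = s.smoothMove p := by
  cases s <;> simp [smoothing, smoothMove, move, place]

/-- A product of permutations applies its last factor first, while strands are followed from the
first letter on; since every letter acts by an involution, the two maps are inverse to each other.
-/
theorem perm_smoothedBraid (w : List (SLetter n k)) (p : Fin (n + 1)) :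
    Braid.perm n (smoothedBraid w) (smoothMoveWord w p) = p := by
  induction w generalizing p with
  | nil => simp [smoothedBraid, smoothMoveWord]
  | cons s w ih =>
    simp only [smoothedBraid, List.map_cons, List.prod_cons, map_mul, Equiv.Perm.mul_apply,
      smoothMoveWord] at ih ⊢
    rw [ih, perm_smoothing, smoothMove_smoothMove]

theorem numCycles_smoothedBraid (w : List (SLetter n k)) :
    numCycles (Braid.perm n (smoothedBraid w)) = numCycles (smoothMoveWord w) := by
  refine numCycles_of_inverse (perm_smoothedBraid w) fun p => ?_
  apply (Braid.perm n (smoothedBraid w)).injective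
  rw [perm_smoothedBraid]

end SLetter

/-! ### Colorings of chord diagrams -/

section Occurrences

variable {k : ℕ}

/-- The total change of a color which changes by `x v` at every letter `v` of a word. -/
def jump (x : Fin k → ZMod 2) (W : List (Fin k)) : ZMod 2 := (W.map x).sum

/-- The sum, over the occurrences of `c` in a word, of the color before this occurrence, for a
color which is `s` at the start and changes by `x v` at every letter `v`. -/
def colorsBefore (x : Fin k → ZMod 2) (c : Fin k) : List (Fin k) → ZMod 2 → ZMod 2
  | [], _ => 0
  | v :: W, s => (if v = c then s else 0) + colorsBefore x c W (s + x v)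

@[simp] theorem jump_nil (x : Fin k → ZMod 2) : jump x [] = 0 := rfl

@[simp] theorem jump_append (x : Fin k → ZMod 2) (W W' : List (Fin k)) :
    jump x (W ++ W') = jump x W + jump x W' := by simp [jump]

theorem jump_add (x y : Fin k → ZMod 2) (W : List (Fin k)) :
    jump (x + y) W = jump x W + jump y W := by
  exact List.sum_map_add

theorem jump_smul (r : ZMod 2) (x : Fin k → ZMod 2) (W : List (Fin k)) :
    jump (r • x) W = r * jump x W := by
  exact List.sum_map_mul_left ..

theorem colorsBefore_append (x : Fin k → ZMod 2) (c : Fin k) (W W' : List (Fin k)) (s : ZMod 2) :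
    colorsBefore x c (W ++ W') s = colorsBefore x c W s + colorsBefore x c W' (s + jump x W) := by
  induction W generalizing s with
  | nil => simp [colorsBefore]
  | cons v W ih => simp [colorsBefore, ih, jump, add_assoc]

theorem colorsBefore_of_notMem (x : Fin k → ZMod 2) {c : Fin k} {W : List (Fin k)} (h : c ∉ W)
    (s : ZMod 2) : colorsBefore x c W s = 0 := by
  induction W generalizing s with
  | nil => rfl
  | cons v W ih =>
    simp only [List.mem_cons, not_or] at h
    simp [colorsBefore, ih h.2, Ne.symm h.1]

/-- Linearity is joint in the jumps and the initial color; it makes the coloring conditions define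
subspaces. -/
theorem colorsBefore_add (x y : Fin k → ZMod 2) (c : Fin k) (W : List (Fin k)) (s t : ZMod 2) :
    colorsBefore (x + y) c W (s + t) = colorsBefore x c W s + colorsBefore y c W t := by
  induction W generalizing s t with
  | nil => simp [colorsBefore]
  | cons v W ih =>
    rw [colorsBefore, Pi.add_apply, add_add_add_comm, ih, colorsBefore, colorsBefore]
    split_ifs <;> ring

theorem colorsBefore_smul (r : ZMod 2) (x : Fin k → ZMod 2) (c : Fin k) (W : List (Fin k))
    (s : ZMod 2) : colorsBefore (r • x) c W (r * s) = r * colorsBefore x c W s := by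
  induction W generalizing s with
  | nil => simp [colorsBefore]
  | cons v W ih =>
    rw [colorsBefore, Pi.smul_apply, smul_eq_mul, ← mul_add, ih, colorsBefore]
    split_ifs <;> ring

end Occurrences

namespace SLetter

variable {n k : ℕ}

theorem move_of_ne {s : SLetter n k} {p : Fin (n + 1)} (h : p ≠ s.place.castSucc)
    (h' : p ≠ s.place.succ) : s.move p = p :=
  Equiv.swap_apply_of_ne_of_ne h h'

/-- The color `x c` is the difference of the colors meeting at the double point `c`. -/
def IsJump : List (SLetter n k) → (Fin (n + 1) → ZMod 2) → (Fin k → ZMod 2) → Prop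
  | [], _, _ => True
  | s :: w, g, x => (∀ c ∈ s.doublePoints, x c = g s.place.castSucc + g s.place.succ) ∧
      IsJump w (fun p => g (s.smoothMove p)) x

theorem IsJump.congr {w : List (SLetter n k)} {g : Fin (n + 1) → ZMod 2} {x y : Fin k → ZMod 2}
    (h : ∀ c ∈ w.flatMap doublePoints, x c = y c) (hx : IsJump w g x) : IsJump w g y := by
  induction w generalizing g with
  | nil => trivial
  | cons s w ih =>
    simp only [List.flatMap_cons, List.mem_append] at h
    exact ⟨fun c hc => by rw [← h c (.inl hc), hx.1 c hc], ih (fun c hc => h c (.inr hc)) hx.2⟩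

/-- The jumps are read off at the double points; as no name is repeated, later letters impose no
second condition. -/
theorem exists_isJump (w : List (SLetter n k)) (hw : (w.flatMap doublePoints).Nodup)
    (g : Fin (n + 1) → ZMod 2) : ∃ x, IsJump w g x := by
  induction w generalizing g with
  | nil => exact ⟨0, trivial⟩
  | cons s w ih =>
    rw [List.flatMap_cons, List.nodup_append] at hw
    obtain ⟨x, hx⟩ := ih hw.2.1 fun p => g (s.smoothMove p)
    refine ⟨fun c => if c ∈ s.doublePoints then g s.place.castSucc + g s.place.succ else x c,
      fun c hc => if_pos hc, hx.congr fun c hc => (if_neg fun h => ?_).symm⟩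
    exact hw.2.2 c h c hc rfl

theorem IsJump.unique {w : List (SLetter n k)} {g : Fin (n + 1) → ZMod 2} {x y : Fin k → ZMod 2}
    (hx : IsJump w g x) (hy : IsJump w g y) : ∀ c ∈ w.flatMap doublePoints, x c = y c := by
  induction w generalizing g with
  | nil => simp
  | cons s w ih =>
    intro c hc
    rw [List.flatMap_cons, List.mem_append] at hc
    rcases hc with h | h
    · rw [hx.1 c h, hy.1 c h]
    · exact ih hx.2 hy.2 c h

/-- A strand changes its color by `x c` at the double point `c`. -/
theorem add_jump_encounters {s : SLetter n k} {g : Fin (n + 1) → ZMod 2} {x : Fin k → ZMod 2}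
    (h : ∀ c ∈ s.doublePoints, x c = g s.place.castSucc + g s.place.succ) (p : Fin (n + 1)) :
    g p + jump x (s.encounters p) = g (s.smoothMove (s.move p)) := by
  cases s with
  | pos i => simp [encounters, doublePoints, smoothMove, move]
  | neg i => simp [encounters, doublePoints, smoothMove, move]
  | dbl i c =>
    have hc := h c (by simp [doublePoints])
    simp only [place] at hc
    -- Adding the difference of the two meeting colors to either of them gives the other one.
    have h2 : ∀ y z : ZMod 2, y + (y + z) = z := by decide
    have h3 : ∀ y z : ZMod 2, z + (y + z) = y := by decide
    by_cases h1 : p = i.castSucc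
    · subst h1
      simp [encounters, doublePoints, smoothMove, move, place, jump, hc, h2]
    · by_cases h1' : p = i.succ
      · subst h1'
        simp [encounters, doublePoints, smoothMove, move, place, jump, hc, h3]
      · rw [move_of_ne h1 h1']
        simp [encounters, place, h1, h1', smoothMove]

theorem encountersWord_subset (w : List (SLetter n k)) (p : Fin (n + 1)) :
    encountersWord w p ⊆ w.flatMap doublePoints := by
  induction w generalizing p with
  | nil => simp [encountersWord]
  | cons s w ih =>
    simp only [encountersWord, List.flatMap_cons]
    refine List.append_subset.2 ⟨fun c hc => ?_, fun c hc => ?_⟩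
    · rw [encounters] at hc
      split_ifs at hc
      · exact List.mem_append_left _ hc
      · simp at hc
    · exact List.mem_append_right _ (ih _ hc)

/-- Only the two strands that meet at the first letter can see a double point there. -/
theorem sum_colorsBefore_cons (s : SLetter n k) (w : List (SLetter n k))
    (g : Fin (n + 1) → ZMod 2) (x : Fin k → ZMod 2) (c : Fin k) :
    ∑ p, colorsBefore x c (encountersWord (s :: w) p) (g p) =
      (if c ∈ s.doublePoints then g s.place.castSucc + g s.place.succ else 0) +
      ∑ p, colorsBefore x c (encountersWord w (s.move p)) (g p + jump x (s.encounters p)) := by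
  simp only [encountersWord, colorsBefore_append, Finset.sum_add_distrib]
  congr 1
  have hne : s.place.castSucc ≠ s.place.succ := by simp [Fin.ext_iff]
  rw [← Finset.sum_subset (Finset.subset_univ {s.place.castSucc, s.place.succ}),
    Finset.sum_pair hne]
  · cases s with
    | pos i => simp [encounters, doublePoints, colorsBefore]
    | neg i => simp [encounters, doublePoints, colorsBefore]
    | dbl i c' =>
      by_cases h : c = c' <;> simp [encounters, doublePoints, colorsBefore, h, eq_comm, place]
  · intro p _ hp
    simp only [Finset.mem_insert, Finset.mem_singleton] at hp
    simp [encounters, hp, colorsBefore]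

/-- The differences of the colors meeting at the double points, computed along the strands. -/
theorem isJump_iff {w : List (SLetter n k)} (hw : (w.flatMap doublePoints).Nodup)
    (g : Fin (n + 1) → ZMod 2) (x : Fin k → ZMod 2) :
    IsJump w g x ↔ ∀ c ∈ w.flatMap doublePoints,
      ∑ p, colorsBefore x c (encountersWord w p) (g p) = x c := by
  induction w generalizing g with
  | nil => simp [IsJump]
  | cons s w ih =>
    rw [List.flatMap_cons, List.nodup_append] at hw
    -- Once the jump at the first letter is right, reindexing by its transposition passes from
    -- singular to smoothed strands.
    have hrest : (∀ c ∈ s.doublePoints, x c = g s.place.castSucc + g s.place.succ) → ∀ c,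
        ∑ p, colorsBefore x c (encountersWord w (s.move p)) (g p + jump x (s.encounters p)) =
        ∑ p, colorsBefore x c (encountersWord w p) (g (s.smoothMove p)) := by
      intro h c
      simp only [add_jump_encounters h]
      exact Equiv.sum_comp (Equiv.swap s.place.castSucc s.place.succ)
        (fun p => colorsBefore x c (encountersWord w p) (g (s.smoothMove p)))
    have hzero : ∀ c ∈ s.doublePoints, ∀ p t, colorsBefore x c (encountersWord w p) t = 0 :=
      fun c hc p t => colorsBefore_of_notMem x
        (fun h => hw.2.2 c hc c (encountersWord_subset w p h) rfl) t
    simp only [IsJump, ih hw.2.1, sum_colorsBefore_cons, List.flatMap_cons, List.mem_append]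
    constructor
    · rintro ⟨h1, h2⟩ c (hc | hc)
      · rw [if_pos hc, ← h1 c hc]
        simp [hzero c hc]
      · rw [if_neg fun h => hw.2.2 c h c hc rfl, hrest h1, zero_add]
        exact h2 c hc
    · intro h
      have h1 : ∀ c ∈ s.doublePoints, x c = g s.place.castSucc + g s.place.succ := by
        intro c hc
        rw [← h c (.inl hc), if_pos hc]
        simp [hzero c hc]
      refine ⟨h1, fun c hc => ?_⟩
      have := h c (.inr hc)
      rwa [if_neg fun h => hw.2.2 c h c hc rfl, hrest h1, zero_add] at this

/-- Following a strand through the smoothed word without changing color is the same as following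
the singular strand, with the jumps. -/
theorem IsJump.exists_color {w : List (SLetter n k)} {g : Fin (n + 1) → ZMod 2}
    {x : Fin k → ZMod 2} (h : IsJump w g x) : ∃ f : Fin (n + 1) → ZMod 2, ∀ p,
      f (smoothMoveWord w p) = g p ∧ f (moveWord w p) = g p + jump x (encountersWord w p) := by
  induction w generalizing g with
  | nil => exact ⟨g, fun p => ⟨rfl, by simp [encountersWord, moveWord]⟩⟩
  | cons s w ih =>
    obtain ⟨f, hf⟩ := ih h.2
    refine ⟨f, fun p => ⟨?_, ?_⟩⟩
    · rw [smoothMoveWord, (hf _).1, smoothMove_smoothMove]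
    · rw [moveWord, (hf _).2, encountersWord, jump_append, ← add_assoc, add_jump_encounters h.1]

theorem smoothMoveWord_surjective (w : List (SLetter n k)) :
    Function.Surjective (smoothMoveWord w) := by
  induction w with
  | nil => exact Function.surjective_id
  | cons s w ih =>
    exact ih.comp fun p => ⟨s.smoothMove p, smoothMove_smoothMove s p⟩

theorem moveWord_surjective (w : List (SLetter n k)) : Function.Surjective (moveWord w) := by
  induction w with
  | nil => exact Function.surjective_id
  | cons s w ih => exact ih.comp fun p => ⟨s.move p, move_move s p⟩

/-- Both conditions say that the colors at the top of the braid agree with those at the bottom, one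
followed along smoothed strands and the other along singular ones. -/
theorem IsJump.invariant_iff {w : List (SLetter n k)} {g : Fin (n + 1) → ZMod 2}
    {x : Fin k → ZMod 2} (h : IsJump w g x) :
    (∀ p, g (smoothMoveWord w p) = g p) ↔
      ∀ p, g (moveWord w p) = g p + jump x (encountersWord w p) := by
  obtain ⟨f, hf⟩ := h.exists_color
  constructor
  · intro hg
    have : f = g := funext fun q => by
      obtain ⟨p, rfl⟩ := smoothMoveWord_surjective w q
      rw [(hf p).1, hg]
    exact fun p => this ▸ (hf p).2
  · intro hg
    have : f = g := funext fun q => by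
      obtain ⟨p, rfl⟩ := moveWord_surjective w q
      rw [(hf p).2, hg]
    exact fun p => this ▸ (hf p).1

/-- Colorings of the strands of a singular braid, constant between double points, which change by
`x c` at the double point `c` and remain compatible with smoothing and closing. -/
def singularColorings (w : List (SLetter n k)) :
    Submodule (ZMod 2) ((Fin (n + 1) → ZMod 2) × (Fin k → ZMod 2)) where
  carrier := {gx | (∀ c, ∑ p, colorsBefore gx.2 c (encountersWord w p) (gx.1 p) = gx.2 c) ∧
    ∀ p, gx.1 (moveWord w p) = gx.1 p + jump gx.2 (encountersWord w p)}
  add_mem' := by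
    rintro ⟨g, x⟩ ⟨g', x'⟩ ⟨h1, h2⟩ ⟨h1', h2'⟩
    refine ⟨fun c => ?_, fun p => ?_⟩
    · simp only [Prod.fst_add, Prod.snd_add, Pi.add_apply, colorsBefore_add,
        Finset.sum_add_distrib] at *
      rw [h1, h1']
    · simp only [Prod.fst_add, Prod.snd_add, Pi.add_apply, jump_add] at *
      rw [h2, h2', add_add_add_comm]
  zero_mem' := by
    refine ⟨fun c => ?_, fun p => ?_⟩
    · have := fun W => colorsBefore_smul (0 : ZMod 2) 0 c W 0
      simp only [zero_smul, zero_mul] at this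
      simp [this]
    · have := fun W => jump_smul (0 : ZMod 2) (0 : Fin k → ZMod 2) W
      simp only [zero_smul, zero_mul] at this
      simp [this]
  smul_mem' := by
    rintro r ⟨g, x⟩ ⟨h1, h2⟩
    refine ⟨fun c => ?_, fun p => ?_⟩
    · simp only [Prod.smul_fst, Prod.smul_snd, Pi.smul_apply, smul_eq_mul, colorsBefore_smul,
        ← Finset.mul_sum] at *
      rw [h1]
    · simp only [Prod.smul_fst, Prod.smul_snd, Pi.smul_apply, smul_eq_mul, jump_smul] at *
      rw [h2, mul_add]

/-- The bottom colors determine the jumps, so forgetting the jumps is a bijection onto the invariant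
colorings. -/
theorem numCycles_smoothMoveWord {w : List (SLetter n k)}
    (hw : (w.flatMap doublePoints).Perm (List.finRange k)) :
    numCycles (smoothMoveWord w) = Module.finrank (ZMod 2) (singularColorings w) := by
  have hnd : (w.flatMap doublePoints).Nodup := hw.nodup_iff.2 (List.nodup_finRange k)
  have hmem : ∀ c, c ∈ w.flatMap doublePoints := fun c => hw.mem_iff.2 (List.mem_finRange c)
  have hjump : ∀ g x, IsJump w g x ↔
      ∀ c, ∑ p, colorsBefore x c (encountersWord w p) (g p) = x c := fun g x => by
    simp [isJump_iff hnd, hmem]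
  symm
  refine (LinearEquiv.ofBijective
    { toFun := fun gx : singularColorings w =>
        (⟨gx.1.1, ((hjump _ _).2 gx.2.1).invariant_iff.2 gx.2.2⟩ :
          invariantColorings (smoothMoveWord w))
      map_add' := fun _ _ => rfl
      map_smul' := fun _ _ => rfl } ⟨?_, ?_⟩).finrank_eq
  · rintro ⟨⟨g, x⟩, h⟩ ⟨⟨g', x'⟩, h'⟩ heq
    obtain rfl : g = g' := congrArg Subtype.val heq
    have : x = x' := funext fun c => ((hjump _ _).2 h.1).unique ((hjump _ _).2 h'.1) c (hmem c)
    subst this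
    rfl
  · rintro ⟨g, hg⟩
    obtain ⟨x, hx⟩ := exists_isJump w hnd g
    exact ⟨⟨(g, x), (hjump _ _).1 hx, hx.invariant_iff.1 hg⟩, rfl⟩

end SLetter

/-! ### From the strands of a singular braid to the components of a string link -/

section Chains

variable {X : Type*} {k : ℕ} {x : Fin k → ZMod 2} {E : X → List (Fin k)} {g : X → ZMod 2}

/-- The passages of a string through the braid concatenate to one word, each starting with the color
the previous one ends with. -/
theorem sum_colorsBefore_of_isChain {p : X} {R : List X}
    (h : (p :: R).IsChain fun p q => g q = g p + jump x (E p)) (c : Fin k) :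
    ((p :: R).map fun q => colorsBefore x c (E q) (g q)).sum =
      colorsBefore x c ((p :: R).flatMap E) (g p) := by
  induction R generalizing p with
  | nil => simp
  | cons q R ih =>
    rw [List.isChain_cons_cons] at h
    rw [List.map_cons, List.sum_cons, ih h.2, List.flatMap_cons (x := p), colorsBefore_append, h.1]

theorem add_jump_getLast_of_isChain {p l : X} {R : List X}
    (h : (p :: R).IsChain fun p q => g q = g p + jump x (E p)) (hl : (p :: R).getLast? = some l) :
    g l + jump x (E l) = g p + jump x ((p :: R).flatMap E) := by
  induction R generalizing p with
  | nil =>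
    obtain rfl : p = l := by simpa using hl
    simp
  | cons q R ih =>
    rw [List.isChain_cons_cons] at h
    rw [ih h.2 (by simpa using hl), List.flatMap_cons (x := p), jump_append, h.1, add_assoc]

theorem eq_of_isChain {g' : X → ZMod 2} {p : X} {R : List X}
    (h : (p :: R).IsChain fun p q => g q = g p + jump x (E p))
    (h' : (p :: R).IsChain fun p q => g' q = g' p + jump x (E p)) (hp : g p = g' p) :
    ∀ q ∈ p :: R, g q = g' q := by
  induction R generalizing p with
  | nil => simpa using hp
  | cons q R ih =>
    rw [List.isChain_cons_cons] at h h'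
    intro r hr
    rcases List.mem_cons.1 hr with rfl | hr
    · exact hp
    · exact ih h.2 h'.2 (by rw [h.1, h'.1, hp]) r hr

theorem exists_isChain (x : Fin k → ZMod 2) (E : X → List (Fin k)) {p : X} {R : List X}
    (hR : (p :: R).Nodup) (s : ZMod 2) : ∃ g : X → ZMod 2, g p = s ∧
      (p :: R).IsChain fun p q => g q = g p + jump x (E p) := by
  classical
  induction R generalizing p s with
  | nil => exact ⟨fun _ => s, rfl, by simp⟩
  | cons q R ih =>
    obtain ⟨g, hg, hc⟩ := ih hR.of_cons (s + jump x (E p))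
    have hp : p ∉ q :: R := hR.notMem
    have hne : ∀ r ∈ q :: R, Function.update g p s r = g r := fun r hr =>
      Function.update_of_ne (by rintro rfl; exact hp hr) _ _
    refine ⟨Function.update g p s, Function.update_self .., List.isChain_cons_cons.2 ⟨?_, ?_⟩⟩
    · rw [hne q (by simp), hg, Function.update_self]
    · refine hc.imp_of_mem_imp fun a b ha hb hab => ?_
      rw [hne a ha, hne b hb, hab]

theorem getLast_or_exists_of_isChain {S T : X → X → Prop} {R : List X} (hS : R.IsChain S)
    (hT : R.IsChain T) {p : X} (hp : p ∈ R) :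
    R.getLast? = some p ∨ ∃ q, S p q ∧ T p q := by
  induction R with
  | nil => simp at hp
  | cons r R ih =>
    cases R with
    | nil =>
      left
      simpa using (List.mem_singleton.1 hp).symm
    | cons q R =>
      rw [List.isChain_cons_cons] at hS hT
      rcases List.mem_cons.1 hp with rfl | hp
      · exact .inr ⟨q, hS.1, hT.1⟩
      · rcases ih hS.2 hT.2 hp with h | h
        · exact .inl (by simpa using h)
        · exact .inr h

end Chains

/-- The colorings of the arcs of a chord diagram, given by the colors of the bottom arcs and the
changes of color at the chords, which are compatible with smoothing the chords and closing. -/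
def ChordDiagram.colorings {m k : ℕ} (D : ChordDiagram m k) :
    Submodule (ZMod 2) ((Fin m → ZMod 2) × (Fin k → ZMod 2)) where
  carrier := {sx | (∀ c, ∑ j, colorsBefore sx.2 c (D.word j) (sx.1 j) = sx.2 c) ∧
    ∀ j, jump sx.2 (D.word j) = 0}
  add_mem' := by
    rintro ⟨g, x⟩ ⟨g', x'⟩ ⟨h1, h2⟩ ⟨h1', h2'⟩
    refine ⟨fun c => ?_, fun p => ?_⟩
    · simp only [Prod.fst_add, Prod.snd_add, Pi.add_apply, colorsBefore_add,
        Finset.sum_add_distrib] at *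
      rw [h1, h1']
    · simp only [Prod.snd_add, jump_add] at *
      rw [h2, h2', add_zero]
  zero_mem' := by
    refine ⟨fun c => ?_, fun p => ?_⟩
    · have := fun W => colorsBefore_smul (0 : ZMod 2) 0 c W 0
      simp only [zero_smul, zero_mul] at this
      simp [this]
    · have := fun W => jump_smul (0 : ZMod 2) (0 : Fin k → ZMod 2) W
      simp only [zero_smul, zero_mul] at this
      simp [this]
  smul_mem' := by
    rintro r ⟨g, x⟩ ⟨h1, h2⟩
    refine ⟨fun c => ?_, fun p => ?_⟩
    · simp only [Prod.smul_fst, Prod.smul_snd, Pi.smul_apply, smul_eq_mul, colorsBefore_smul,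
        ← Finset.mul_sum] at *
      rw [h1]
    · simp only [Prod.smul_snd, jump_smul] at *
      rw [h2, mul_zero]

namespace SingularStringLink

variable {m k : ℕ} (L : SingularStringLink m k)

theorem exists_route_eq_cons :
    ∃ (start : Fin m → Fin (L.n + 1)) (rest : Fin m → List (Fin (L.n + 1))),
      (∀ j, L.route j = start j :: rest j) ∧ ∀ j, (start j : ℕ) = j := by
  have : ∀ j, ∃ p R, L.route j = p :: R ∧ (p : ℕ) = j := by
    intro j
    have h := L.route_start j
    cases hR : L.route j with
    | nil => simp [hR] at h
    | cons p R => exact ⟨p, R, rfl, by simpa [hR] using h⟩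
  choose start rest h using this
  exact ⟨start, rest, fun j => (h j).1, fun j => (h j).2⟩

theorem exists_getLast_route {start : Fin m → Fin (L.n + 1)} (hs : ∀ j, (start j : ℕ) = j)
    (j : Fin m) :
    ∃ l, (L.route j).getLast? = some l ∧ SLetter.moveWord L.word l = start j := by
  obtain ⟨l, hl, h⟩ := Option.map_eq_some_iff.1 (L.route_end j)
  exact ⟨l, hl, Fin.ext (by rw [h, hs])⟩

theorem sum_route {M : Type*} [AddCommMonoid M] (F : Fin (L.n + 1) → M) :
    ∑ p, F p = ∑ j, ((L.route j).map F).sum := by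
  have h := (L.route_cover.map F).sum_eq
  rw [List.map_flatten, List.sum_flatten, List.map_map, ← List.ofFn_eq_map, List.sum_ofFn,
    List.map_ofFn, List.sum_ofFn] at h
  exact h.symm

theorem mem_route (p : Fin (L.n + 1)) : ∃ j, p ∈ L.route j := by
  have := L.route_cover.mem_iff.2 (List.mem_finRange p)
  simpa [List.mem_flatten, List.mem_ofFn] using this

theorem nodup_flatten_route : (List.ofFn L.route).flatten.Nodup :=
  L.route_cover.nodup_iff.2 (List.nodup_finRange _)

theorem nodup_route (j : Fin m) : (L.route j).Nodup :=
  (List.nodup_flatten.1 L.nodup_flatten_route).1 _ (List.mem_ofFn.2 ⟨j, rfl⟩)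

theorem eq_of_mem_route {p : Fin (L.n + 1)} {i j : Fin m} (hi : p ∈ L.route i)
    (hj : p ∈ L.route j) : i = j := by
  have h := (List.nodup_flatten.1 L.nodup_flatten_route).2
  rw [List.pairwise_ofFn] at h
  rcases lt_trichotomy i j with hij | hij | hij
  · exact (h hij hi hj).elim
  · exact hij
  · exact (h hij hj hi).elim

/-- The colorings of a singular string link depend only on its chord diagram. -/
theorem finrank_singularColorings {D : ChordDiagram m k} (hD : L.HasChordDiagram D) :
    Module.finrank (ZMod 2) (SLetter.singularColorings L.word) =
      Module.finrank (ZMod 2) D.colorings := by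
  classical
  obtain ⟨start, rest, hroute, hstart⟩ := L.exists_route_eq_cons
  have hchain : ∀ (g : Fin (L.n + 1) → ZMod 2) (x : Fin k → ZMod 2), (∀ p, g (SLetter.moveWord L.word p) =
      g p + jump x (SLetter.encountersWord L.word p)) → ∀ j, (L.route j).IsChain
        fun p q => g q = g p + jump x (SLetter.encountersWord L.word p) := by
    intro g x h j
    refine (L.route_step j).imp fun p q hpq => ?_
    rw [← hpq, h]
  have hsum : ∀ (g : Fin (L.n + 1) → ZMod 2) (x : Fin k → ZMod 2), (∀ j, (L.route j).IsChain
        fun p q => g q = g p + jump x (SLetter.encountersWord L.word p)) → ∀ c,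
      ∑ p, colorsBefore x c (SLetter.encountersWord L.word p) (g p) =
        ∑ j, colorsBefore x c (D.word j) (g (start j)) := by
    intro g x h c
    rw [L.sum_route]
    refine Finset.sum_congr rfl fun j _ => ?_
    have hj := h j
    rw [hroute] at hj
    rw [← hD j, hroute, sum_colorsBefore_of_isChain hj]
  have hlast : ∀ (g : Fin (L.n + 1) → ZMod 2) (x : Fin k → ZMod 2), (∀ j, (L.route j).IsChain
        fun p q => g q = g p + jump x (SLetter.encountersWord L.word p)) → ∀ j l,
      (L.route j).getLast? = some l →
      g l + jump x (SLetter.encountersWord L.word l) = g (start j) + jump x (D.word j) := by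
    intro g x h j l hl
    have hj := h j
    rw [hroute] at hj hl
    rw [← hD j, hroute, add_jump_getLast_of_isChain hj hl]
  refine (LinearEquiv.ofBijective
    { toFun := fun gx : SLetter.singularColorings L.word =>
        (⟨(fun j => gx.1.1 (start j), gx.1.2), fun c => ?_, fun j => ?_⟩ : D.colorings)
      map_add' := fun _ _ => rfl
      map_smul' := fun _ _ => rfl } ⟨?_, ?_⟩).finrank_eq
  · rw [← hsum _ _ (hchain _ _ gx.2.2)]
    exact gx.2.1 c
  · obtain ⟨l, hl, hl'⟩ := L.exists_getLast_route hstart j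
    have := hlast _ _ (hchain _ _ gx.2.2) j l hl
    rw [← gx.2.2, hl'] at this
    simpa using this
  -- Injectivity: the initial colors propagate along the routes, which cover all places.
  · rintro ⟨⟨g, x⟩, h⟩ ⟨⟨g', x'⟩, h'⟩ heq
    have heq := congrArg Subtype.val heq
    obtain rfl : x = x' := congrArg Prod.snd heq
    have hs : ∀ j, g (start j) = g' (start j) := fun j => congrFun (congrArg Prod.fst heq) j
    have : g = g' := funext fun p => by
      obtain ⟨j, hj⟩ := L.mem_route p
      have h1 := hchain _ _ h.2 j
      have h2 := hchain _ _ h'.2 j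
      rw [hroute] at h1 h2 hj
      exact eq_of_isChain h1 h2 (hs j) p hj
    subst this
    rfl
  -- Surjectivity: colors are propagated along each route separately and glued, each place lying on
  -- exactly one route.
  · rintro ⟨⟨s, x⟩, h1, h2⟩
    have hex : ∀ j, ∃ g : Fin (L.n + 1) → ZMod 2, g (start j) = s j ∧ (L.route j).IsChain
        fun p q => g q = g p + jump x (SLetter.encountersWord L.word p) := by
      intro j
      have := L.nodup_route j
      rw [hroute] at this ⊢
      exact exists_isChain x _ this (s j)
    choose G hG hGc using hex
    choose comp hcomp using L.mem_route
    have hcomp' : ∀ j, ∀ p ∈ L.route j, G (comp p) p = G j p := fun j p hp => by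
      rw [L.eq_of_mem_route (hcomp p) hp]
    have hgc : ∀ j, (L.route j).IsChain fun p q => G (comp q) q =
        G (comp p) p + jump x (SLetter.encountersWord L.word p) := fun j =>
      (hGc j).imp_of_mem_imp fun p q hp hq hpq => by rw [hcomp' j p hp, hcomp' j q hq, hpq]
    have hgs : ∀ j, G (comp (start j)) (start j) = s j := fun j => by
      rw [hcomp' j _ (by rw [hroute]; simp), hG]
    refine ⟨⟨(fun p => G (comp p) p, x), fun c => ?_, fun p => ?_⟩, ?_⟩
    · rw [hsum (fun p => G (comp p) p) x hgc]
      simpa only [hgs] using h1 c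
    · obtain ⟨j, hj⟩ := L.mem_route p
      dsimp only
      -- Inside a route the next color is right by construction; at its end, closing up works
      -- because the total jump `h2` vanishes.
      rcases getLast_or_exists_of_isChain (L.route_step j) (hgc j) hj with hl | ⟨q, hq, hq'⟩
      · obtain ⟨l, hl', hm⟩ := L.exists_getLast_route hstart j
        obtain rfl : l = p := Option.some_injective _ (hl'.symm.trans hl)
        rw [hlast (fun p => G (comp p) p) x hgc j l hl', hm, h2 j, add_zero]
      · rw [hq, hq']
    · exact Subtype.ext (Prod.ext (funext hgs) rfl)

/-- The number of components of the closure, after smoothing the double points. -/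
theorem numCycles_smoothedBraid_eq {D : ChordDiagram m k} (hD : L.HasChordDiagram D) :
    numCycles (Braid.perm L.n (SLetter.smoothedBraid L.word)) =
      Module.finrank (ZMod 2) D.colorings := by
  rw [SLetter.numCycles_smoothedBraid, SLetter.numCycles_smoothMoveWord L.double_points,
    L.finrank_singularColorings hD]

/-- The leading term of the series of a singular string link. -/
theorem coeff_homflySeries {P : ∀ n : ℕ, Braid n → LaurentLM} (hP : IsFramedHomfly P)
    {K : Type*} [Field K] [CharZero K] {a : K} (ha : a ≠ 0) (b : K) {D : ChordDiagram m k}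
    (hD : L.HasChordDiagram D) :
    (∀ j : ℤ, j < k → (L.homflySeries P a b).coeff j = 0) ∧
      (L.homflySeries P a b).coeff k =
        a ^ k * b ^ (Module.finrank (ZMod 2) D.colorings - 1) := by
  have hlen : (L.word.flatMap SLetter.doublePoints).length = k := by
    rw [L.double_points.length_eq, List.length_finRange]
  have h : L.homflySeries P a b = mSeries a ^ k *
      LaurentLM.subst a b (P L.n (SLetter.smoothedBraid L.word)) := by
    rw [homflySeries, SLetter.extend_eq (hP.skein L.n), hlen, one_mul, ← substHom_apply a b ha,
      ← substHom_apply a b ha, map_mul, map_pow, substHom_apply a b ha LaurentLM.m, LaurentLM.m,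
      subst_single]
    simp
  rw [h, ← L.numCycles_smoothedBraid_eq hD]
  exact coeff_mSeries_pow_mul a k (hP.hasValue ha b _ _)

end SingularStringLink

/-! ### Symmetric matrices over `ℤ/2` -/

namespace Matrix

variable {ι : Type*} [Fintype ι] {A : Matrix ι ι (ZMod 2)}

theorem IsSymm.dotProduct_mulVec_comm (hA : A.IsSymm) (x y : ι → ZMod 2) :
    x ⬝ᵥ A *ᵥ y = A *ᵥ x ⬝ᵥ y := by
  rw [dotProduct_mulVec, ← mulVec_transpose, hA.eq]

/-- Modulo 2 the cross terms of the quadratic form cancel in pairs, so it is additive and can be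
compared on basis vectors, where `t * t = t`. -/
theorem IsSymm.diag_dotProduct (hA : A.IsSymm) (x : ι → ZMod 2) :
    A.diag ⬝ᵥ x = x ⬝ᵥ A *ᵥ x := by
  classical
  have h2 : ∀ t : ZMod 2, t + t = 0 := by decide
  have hsq : ∀ t : ZMod 2, t * t = t := by decide
  let f : (ι → ZMod 2) →+ ZMod 2 :=
    { toFun := fun x => A.diag ⬝ᵥ x
      map_zero' := by simp
      map_add' := fun x y => dotProduct_add _ _ _ }
  let g : (ι → ZMod 2) →+ ZMod 2 :=
    { toFun := fun x => x ⬝ᵥ A *ᵥ x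
      map_zero' := by simp
      map_add' := fun x y => by
        have : y ⬝ᵥ A *ᵥ x = x ⬝ᵥ A *ᵥ y := by
          rw [hA.dotProduct_mulVec_comm, dotProduct_comm]
        rw [mulVec_add, dotProduct_add, add_dotProduct, add_dotProduct, this]
        linear_combination h2 (x ⬝ᵥ A *ᵥ y) }
  have : f = g := AddMonoidHom.functions_ext _ _ _ fun i t => by
    change A.diag ⬝ᵥ Pi.single i t = Pi.single i t ⬝ᵥ A *ᵥ Pi.single i t
    simp [mulVec_single]
    linear_combination (-A i i) * hsq t
  exact DFunLike.congr_fun this x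

/-- The diagonal of a symmetric matrix over `ℤ/2` lies in its column space. -/
theorem IsSymm.exists_mulVec_eq_diag (hA : A.IsSymm) : ∃ y, A *ᵥ y = A.diag := by
  classical
  let φ : Module.Dual (ZMod 2) (ι → ZMod 2) := dotProductBilin (ZMod 2) (ZMod 2) A.diag
  -- Pairing with the diagonal kills `ker A`, so it factors through `A`; by symmetry the coordinates
  -- of the factor `ψ` are the required vector.
  have hφ : φ ∈ (LinearMap.ker A.mulVecLin).dualAnnihilator := by
    rw [Submodule.mem_dualAnnihilator]
    intro x hx
    have hx : A *ᵥ x = 0 := hx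
    change A.diag ⬝ᵥ x = 0
    rw [hA.diag_dotProduct, hx, dotProduct_zero]
  rw [← LinearMap.range_dualMap_eq_dualAnnihilator_ker] at hφ
  obtain ⟨ψ, hψ⟩ := hφ
  refine ⟨fun i => ψ (Pi.single i 1), funext fun i => ?_⟩
  have hi := LinearMap.congr_fun hψ (Pi.single i 1)
  have h1 : φ (Pi.single i 1) = A.diag i := by
    change A.diag ⬝ᵥ Pi.single i 1 = _
    simp
  rw [h1] at hi
  rw [← hi]
  change _ = ψ (A *ᵥ Pi.single i 1)
  conv_rhs => rw [LinearMap.pi_apply_eq_sum_univ ψ]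
  refine Finset.sum_congr rfl fun j _ => ?_
  have : A i j = A j i := congrFun (congrFun hA j) i
  have hs : (fun i' => if j = i' then (1 : ZMod 2) else 0) = Pi.single j 1 := by
    ext i'
    simp [Pi.single_apply, eq_comm]
  simp [this, hs]

theorem finrank_ker_mulVecLin (A : Matrix ι ι (ZMod 2)) :
    A.rank + Module.finrank (ZMod 2) (LinearMap.ker A.mulVecLin) = Fintype.card ι := by
  classical
  rw [Matrix.rank, LinearMap.finrank_range_add_finrank_ker, Module.finrank_fintype_fun_eq_card]

/-- The rank one update of a symmetric matrix along a vector `u`. -/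
def update (A : Matrix ι ι (ZMod 2)) (u : ι → ZMod 2) : Matrix ι ι (ZMod 2) :=
  A + vecMulVec (A *ᵥ u) (A *ᵥ u)

theorem IsSymm.update (hA : A.IsSymm) (u : ι → ZMod 2) : (A.update u).IsSymm := by
  rw [IsSymm, Matrix.update, transpose_add, hA.eq, transpose_vecMulVec]

theorem update_mulVec (A : Matrix ι ι (ZMod 2)) (u x : ι → ZMod 2) :
    A.update u *ᵥ x = A *ᵥ (x + (A *ᵥ u ⬝ᵥ x) • u) := by
  rw [update, add_mulVec, vecMulVec_mulVec, mulVec_add, mulVec_smul]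
  ext i
  simp

theorem diag_update (A : Matrix ι ι (ZMod 2)) (u : ι → ZMod 2) :
    (A.update u).diag = A.diag + A *ᵥ u := by
  have hsq : ∀ t : ZMod 2, t * t = t := by decide
  ext i
  simp [update, vecMulVec_apply, hsq]

/-- Pairing the kernel equation with `u` shows that the correction term vanishes, so the kernel does
not change. -/
theorem IsSymm.rank_update_of_eq_zero (hA : A.IsSymm) {u : ι → ZMod 2}
    (hu : A *ᵥ u ⬝ᵥ u = 0) : (A.update u).rank = A.rank := by
  have : LinearMap.ker (A.update u).mulVecLin = LinearMap.ker A.mulVecLin := by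
    ext x
    simp only [LinearMap.mem_ker, mulVecLin_apply, update_mulVec]
    constructor
    · intro h
      have h' := congrArg (u ⬝ᵥ ·) h
      simp only [hA.dotProduct_mulVec_comm, dotProduct_add, dotProduct_smul, hu, smul_zero,
        add_zero, dotProduct_zero] at h'
      simpa [h'] using h
    · intro h
      have : A *ᵥ u ⬝ᵥ x = 0 := by rw [← hA.dotProduct_mulVec_comm, h, dotProduct_zero]
      simpa [this] using h
  have h1 := finrank_ker_mulVecLin A
  have h2 := finrank_ker_mulVecLin (A.update u)
  rw [this] at h2
  omega

/-- Here `u` spans a nondegenerate orthogonal summand, which the update kills: the kernel grows by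
`u`. -/
theorem IsSymm.rank_update_of_eq_one (hA : A.IsSymm) {u : ι → ZMod 2}
    (hu : A *ᵥ u ⬝ᵥ u = 1) : (A.update u).rank + 1 = A.rank := by
  have h2 : ∀ t : ZMod 2, t + t = 0 := by decide
  have e : LinearMap.ker (A.update u).mulVecLin ≃ₗ[ZMod 2]
      LinearMap.ker A.mulVecLin × ZMod 2 :=
    { toFun := fun x => (⟨x.1 + (A *ᵥ u ⬝ᵥ x.1) • u, by
        have := x.2
        rwa [LinearMap.mem_ker, mulVecLin_apply, update_mulVec] at this⟩, A *ᵥ u ⬝ᵥ x.1)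
      invFun := fun z => ⟨z.1.1 + z.2 • u, by
        have h : A *ᵥ z.1.1 = 0 := z.1.2
        have h' : A *ᵥ u ⬝ᵥ z.1.1 = 0 := by rw [← hA.dotProduct_mulVec_comm, h, dotProduct_zero]
        rw [LinearMap.mem_ker, mulVecLin_apply, update_mulVec, dotProduct_add, h',
          dotProduct_smul, hu, zero_add, smul_eq_mul, mul_one, add_assoc, ← add_smul, h2,
          zero_smul, add_zero, h]⟩
      map_add' := fun x y => by
        ext
        · simp [dotProduct_add, add_smul]; ring
        · simp [dotProduct_add]
      map_smul' := fun r x => by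
        ext
        · simp [dotProduct_smul, mul_add]; ring
        · simp [dotProduct_smul]
      left_inv := fun x => Subtype.ext (by
        simp only [add_assoc, ← add_smul, h2, zero_smul, add_zero])
      right_inv := fun z => by
        have h : A *ᵥ z.1.1 = 0 := z.1.2
        have h' : A *ᵥ u ⬝ᵥ z.1.1 = 0 := by rw [← hA.dotProduct_mulVec_comm, h, dotProduct_zero]
        have h'' : A *ᵥ u ⬝ᵥ (z.1.1 + z.2 • u) = z.2 := by
          rw [dotProduct_add, h', dotProduct_smul, hu]; simp
        refine Prod.ext (Subtype.ext ?_) h''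
        simp only [h'', add_assoc, ← add_smul, h2, zero_smul, add_zero] }
  have h1 := finrank_ker_mulVecLin A
  have h3 := finrank_ker_mulVecLin (A.update u)
  rw [e.finrank_eq, Module.finrank_prod, Module.finrank_self] at h3
  omega

/-- The value of a symmetric bilinear form over `ℤ/2` on a characteristic vector is the parity of
its rank. -/
theorem IsSymm.diag_dotProduct_eq_rank (hA : A.IsSymm) {y : ι → ZMod 2} (hy : A *ᵥ y = A.diag) :
    A.diag ⬝ᵥ y = (A.rank : ZMod 2) := by
  classical
  have h2 : ∀ t : ZMod 2, t + t = 0 := by decide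
  have hcases : ∀ t : ZMod 2, t ≠ 0 → t = 1 := by decide
  induction hr : A.rank using Nat.strong_induction_on generalizing A y with
  | _ r ih =>
    subst hr
    -- With a diagonal entry `1`, the update along that basis vector lowers the rank by one, keeps
    -- `y'` characteristic and changes the value by one.
    have hodd : ∀ {A' : Matrix ι ι (ZMod 2)} (_ : A'.IsSymm) {y' : ι → ZMod 2}
        (_ : A' *ᵥ y' = A'.diag), A'.rank = A.rank → A'.diag ≠ 0 →
        A'.diag ⬝ᵥ y' = (A'.rank : ZMod 2) := by
      intro A' hA' y' hy' hrank hne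
      obtain ⟨i, hi⟩ := Function.ne_iff.1 hne
      have hi : A' i i = 1 := hcases _ hi
      set u : ι → ZMod 2 := Pi.single i 1 with hu
      have hud : A'.diag ⬝ᵥ u = 1 := by simp [hu, hi]
      have hq : A' *ᵥ u ⬝ᵥ u = 1 := by rw [← hA'.dotProduct_mulVec_comm, ← hA'.diag_dotProduct, hud]
      have hlt := hA'.rank_update_of_eq_one hq
      have huy : A' *ᵥ u ⬝ᵥ y' = 1 := by
        rw [← hA'.dotProduct_mulVec_comm, hy', dotProduct_comm, hud]
      have := ih _ (by omega) (hA'.update u) (y := y') (by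
        rw [update_mulVec, huy, mulVec_add, one_smul, hy', diag_update]) rfl
      rw [diag_update, add_dotProduct, huy] at this
      rw [← hlt, Nat.cast_add, ← this, Nat.cast_one, add_assoc, h2, add_zero]
    by_cases hd : A.diag = 0
    · by_cases h0 : A = 0
      · subst h0
        simp
      -- For a nonzero alternating form, the update along a basis vector outside the kernel keeps
      -- the rank but makes the diagonal nonzero; `y + u` is then characteristic.
      · obtain ⟨i, j, hij⟩ : ∃ i j, A i j ≠ 0 := by
          by_contra! h
          exact h0 (Matrix.ext h)
        set u : ι → ZMod 2 := Pi.single j 1 with hu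
        have hq : A *ᵥ u ⬝ᵥ u = 0 := by
          rw [← hA.dotProduct_mulVec_comm, ← hA.diag_dotProduct, hd, zero_dotProduct]
        have huy : A *ᵥ u ⬝ᵥ y = 0 := by
          rw [← hA.dotProduct_mulVec_comm, hy, hd, dotProduct_zero]
        have hrank := hA.rank_update_of_eq_zero hq
        have := hodd (hA.update u) (y' := y + u) (by
          rw [update_mulVec, dotProduct_add, huy, hq, diag_update, mulVec_add, mulVec_add, hy]
          simp) hrank (by
          rw [diag_update, hd, zero_add]
          intro h
          have := congrFun h i
          simp [hu] at this
          exact hij this)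
        rw [hrank, diag_update, hd, zero_add, dotProduct_add, huy, hq] at this
        rw [← this, hd]
        simp
    · exact hodd hA hy rfl hd

/-- The kernel of a symmetric matrix bordered by its diagonal. -/
def borderedKer (A : Matrix ι ι (ZMod 2)) : Submodule (ZMod 2) ((ι → ZMod 2) × ZMod 2) where
  carrier := {z | A *ᵥ z.1 + z.2 • A.diag = 0 ∧ A.diag ⬝ᵥ z.1 = 0}
  add_mem' := by
    rintro ⟨x, u⟩ ⟨x', u'⟩ ⟨h1, h2⟩ ⟨h1', h2'⟩
    simp only [Set.mem_ofPred_eq, Prod.mk_add_mk, mulVec_add, add_smul, dotProduct_add] at *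
    exact ⟨by rw [add_add_add_comm, h1, h1', add_zero], by rw [h2, h2', add_zero]⟩
  zero_mem' := by simp
  smul_mem' := by
    rintro r ⟨x, u⟩ ⟨h1, h2⟩
    simp only [Set.mem_ofPred_eq, Prod.smul_mk, mulVec_smul, smul_assoc, dotProduct_smul] at *
    exact ⟨by rw [← smul_add, h1, smul_zero], by rw [h2, smul_zero]⟩

/-- For `A y = diag`, the first equation puts `x + t y` in `ker A`, where the diagonal pairs to
zero. The second then says `t * rank = 0`, so `t` is zero or free according to parity. -/
theorem IsSymm.finrank_borderedKer (hA : A.IsSymm) :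
    (Odd A.rank → Module.finrank (ZMod 2) A.borderedKer = Fintype.card ι - A.rank) ∧
    (Even A.rank → Module.finrank (ZMod 2) A.borderedKer = Fintype.card ι - A.rank + 1) := by
  obtain ⟨y, hy⟩ := hA.exists_mulVec_eq_diag
  have hrank := finrank_ker_mulVecLin A
  have hdy := hA.diag_dotProduct_eq_rank hy
  have h2 : ∀ t : ZMod 2, t + t = 0 := by decide
  have hker : ∀ z, A *ᵥ z = 0 → A.diag ⬝ᵥ z = 0 := fun z hz => by
    rw [hA.diag_dotProduct, hz, dotProduct_zero]
  have hsum : ∀ z ∈ A.borderedKer, A *ᵥ (z.1 + z.2 • y) = 0 := fun z hz => by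
    rw [mulVec_add, mulVec_smul, hy]
    exact hz.1
  constructor
  · intro hr
    rw [ZMod.natCast_eq_one_iff_odd.2 hr] at hdy
    have hz2 : ∀ z ∈ A.borderedKer, z.2 = 0 := fun z hz => by
      have := hker _ (hsum z hz)
      rwa [dotProduct_add, hz.2, dotProduct_smul, hdy, zero_add, smul_eq_mul, mul_one] at this
    have e : A.borderedKer ≃ₗ[ZMod 2] LinearMap.ker A.mulVecLin :=
      { toFun := fun z => ⟨z.1.1, by
          have := hsum z.1 z.2
          rwa [hz2 z.1 z.2, zero_smul, add_zero] at this⟩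
        invFun := fun x => ⟨(x.1, 0), by
          have hx : A *ᵥ x.1 = 0 := x.2
          exact ⟨by simp [hx], hker _ hx⟩⟩
        map_add' := fun _ _ => rfl
        map_smul' := fun _ _ => rfl
        left_inv := fun z => Subtype.ext (Prod.ext rfl (hz2 z.1 z.2).symm)
        right_inv := fun _ => rfl }
    rw [e.finrank_eq]
    omega
  · intro hr
    rw [ZMod.natCast_eq_zero_iff_even.2 hr] at hdy
    have e : A.borderedKer ≃ₗ[ZMod 2] LinearMap.ker A.mulVecLin × ZMod 2 :=
      { toFun := fun z => (⟨z.1.1 + z.1.2 • y, hsum z.1 z.2⟩, z.1.2)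
        invFun := fun x => ⟨(x.1.1 + x.2 • y, x.2), by
          have hx : A *ᵥ x.1.1 = 0 := x.1.2
          refine ⟨?_, ?_⟩
          · simp only [mulVec_add, mulVec_smul, hx, hy, zero_add, ← add_smul, h2, zero_smul]
          · simp only [dotProduct_add, dotProduct_smul, hdy, hker _ hx, smul_zero, add_zero]⟩
        map_add' := fun z z' => by
          ext
          · simp [add_smul]; ring
          · simp
        map_smul' := fun r z => by
          ext
          · simp; ring
          · simp
        left_inv := fun z => Subtype.ext (Prod.ext (by
          simp only [add_assoc, ← add_smul, h2, zero_smul, add_zero]) rfl)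
        right_inv := fun x => Prod.ext (Subtype.ext (by
          simp only [add_assoc, ← add_smul, h2, zero_smul, add_zero])) rfl }
    rw [e.finrank_eq, Module.finrank_prod, Module.finrank_self]
    omega

end Matrix

/-! ### The adjacency matrix and the colorings of a chord diagram -/

theorem sum_get_eq_count {k : ℕ} (W : List (Fin k)) (w : Fin k) :
    ∑ q : Fin W.length, (if W.get q = w then 1 else 0) = W.count w := by
  induction W with
  | nil => rfl
  | cons u W ih =>
    change ∑ q : Fin (W.length + 1), (if (u :: W).get q = w then 1 else 0) = _
    rw [Fin.sum_univ_succ, List.count_cons, ← ih, add_comm]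
    by_cases h : u = w <;> simp [h]

theorem countBefore_cons {k : ℕ} (u : Fin k) (W : List (Fin k)) (v w : Fin k) :
    countBefore (u :: W) v w = (if u = v then W.count w else 0) + countBefore W v w := by
  classical
  rw [← sum_get_eq_count]
  simp only [countBefore, Finset.card_filter, ← Finset.univ_product_univ, Finset.sum_product]
  change ∑ p : Fin (W.length + 1), ∑ q : Fin (W.length + 1), _ = _
  simp only [Fin.sum_univ_succ]
  by_cases h : u = v <;> simp [h]

theorem countBefore_nil {k : ℕ} (v w : Fin k) : countBefore [] v w = 0 := by
  simp [countBefore]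

/-- Pairs of places are sorted by order; coinciding places occur only for `v = w`. -/
theorem countBefore_add_swap {k : ℕ} (W : List (Fin k)) (v w : Fin k) :
    countBefore W v w + countBefore W w v + (if v = w then W.count v else 0) =
      W.count v * W.count w := by
  induction W with
  | nil => simp [countBefore_nil]
  | cons u W ih =>
    simp only [countBefore_cons, List.count_cons, beq_iff_eq]
    by_cases h : v = w
    · subst h
      by_cases hu : u = v
      · simp [hu] at ih ⊢; linarith
      · simp [hu] at ih ⊢; linarith
    · by_cases hu : u = v
      · subst hu
        simp [h] at ih ⊢; linarith
      · by_cases hw : u = w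
        · subst hw
          simp [h, hu] at ih ⊢; linarith
        · simp [h, hu, hw] at ih ⊢; linarith

theorem colorsBefore_eq {k : ℕ} (x : Fin k → ZMod 2) (c : Fin k) (W : List (Fin k)) (s : ZMod 2) :
    colorsBefore x c W s = W.count c * s + ∑ v, x v * (countBefore W v c : ZMod 2) := by
  induction W generalizing s with
  | nil => simp [colorsBefore, countBefore_nil]
  | cons u W ih =>
    simp only [colorsBefore, ih, countBefore_cons, List.count_cons, beq_iff_eq, Nat.cast_add,
      mul_add, Finset.sum_add_distrib, Nat.cast_ite, Nat.cast_zero, mul_ite, mul_zero,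
      Finset.sum_ite_eq, Finset.mem_univ, if_true]
    split_ifs <;> push_cast <;> ring

theorem jump_eq {k : ℕ} (x : Fin k → ZMod 2) (W : List (Fin k)) :
    jump x W = ∑ v, (W.count v : ZMod 2) * x v := by
  induction W with
  | nil => simp
  | cons u W ih =>
    have : jump x (u :: W) = x u + jump x W := by simp [jump]
    rw [this, ih]
    simp [List.count_cons, add_mul, Finset.sum_add_distrib, add_comm]

namespace ChordDiagram

variable {k : ℕ} (D : ChordDiagram 2 k)

theorem count_add_count (v : Fin k) : (D.word 0).count v + (D.word 1).count v = 2 := by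
  have h := D.two_endpoints v
  rwa [Fin.sum_univ_two] at h

/-- Because there are exactly two strings, one vector of parities, the diagonal, serves both. -/
theorem count_one_eq (v : Fin k) :
    ((D.word 1).count v : ZMod 2) = (D.word 0).count v := by
  have h := congrArg (Nat.cast : ℕ → ZMod 2) (D.count_add_count v)
  have key : ∀ s t : ZMod 2, s + t = 0 → t = s := by decide
  rw [Nat.cast_add] at h
  exact key _ _ (h.trans rfl)

theorem adj_self (v : Fin k) : D.intersectionGraph.adj v v = ((D.word 0).count v : ZMod 2) := by
  have h := D.count_add_count v
  have h0 : (D.word 0).count v = 0 ∨ (D.word 0).count v = 1 ∨ (D.word 0).count v = 2 := by omega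
  simp only [LabeledDigraph.adj, Matrix.of_apply, if_true, intersectionGraph, Fin.sum_univ_two]
  rcases h0 with h0 | h0 | h0
  · have h1 : (D.word 1).count v = 2 := by omega
    rw [h0, h1, if_pos ⟨1, by simp [Multiset.replicate_succ]⟩]
    rfl
  · have h1 : (D.word 1).count v = 1 := by omega
    rw [h0, h1, if_neg (by decide)]
    rfl
  · have h1 : (D.word 1).count v = 0 := by omega
    rw [h0, h1, if_pos ⟨0, by simp [Multiset.replicate_succ]⟩]
    rfl

theorem adj_of_ne {v w : Fin k} (h : v ≠ w) : D.intersectionGraph.adj v w =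
    ((countBefore (D.word 0) v w + countBefore (D.word 1) v w : ℕ) : ZMod 2) := by
  simp only [LabeledDigraph.adj, Matrix.of_apply, intersectionGraph, Fin.sum_univ_two,
    ne_eq, h, not_false_eq_true, true_and, if_false]
  split_ifs with ho
  · exact (ZMod.natCast_eq_one_iff_odd.2 ho).symm
  · exact (ZMod.natCast_eq_zero_iff_even.2 (Nat.not_odd_iff_even.1 ho)).symm

/-- The edges in both directions together count the pairs of endpoints on a common string; by equal
parities the two strings contribute equally modulo 2. -/
theorem adj_isSymm : D.intersectionGraph.adj.IsSymm := by
  ext v w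
  rw [Matrix.transpose_apply]
  rcases eq_or_ne v w with rfl | h
  · rfl
  · rw [D.adj_of_ne h, D.adj_of_ne h.symm]
    have h0 := congrArg (Nat.cast : ℕ → ZMod 2) (countBefore_add_swap (D.word 0) v w)
    have h1 := congrArg (Nat.cast : ℕ → ZMod 2) (countBefore_add_swap (D.word 1) v w)
    simp only [if_neg h, add_zero, Nat.cast_add, Nat.cast_mul, count_one_eq] at h0 h1 ⊢
    have h2 : ∀ t : ZMod 2, t + t = 0 := by decide
    linear_combination h0 + h1 - h2 (countBefore (D.word 0) v w) - h2 (countBefore (D.word 1) v w)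
      + h2 ((D.word 0).count v * (D.word 0).count w)

/-- A chord on a single string precedes itself once, a chord joining the strings never, opposite to
the diagonal convention. The correction accounts for the term `x c` in the coloring equation. -/
theorem countBefore_eq_adj (v c : Fin k) :
    ((countBefore (D.word 0) v c + countBefore (D.word 1) v c : ℕ) : ZMod 2) =
      D.intersectionGraph.adj v c + if v = c then 1 else 0 := by
  rcases eq_or_ne v c with rfl | h
  · rw [adj_self, if_pos rfl]
    have h := D.count_add_count v
    have h0 := countBefore_add_swap (D.word 0) v v
    have h1 := countBefore_add_swap (D.word 1) v v
    simp only [if_true] at h0 h1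
    have hc : (D.word 0).count v = 0 ∨ (D.word 0).count v = 1 ∨ (D.word 0).count v = 2 := by omega
    rcases hc with hc | hc | hc
    · have hd : (D.word 1).count v = 2 := by omega
      rw [hc] at h0 ⊢; rw [hd] at h1
      rw [show countBefore (D.word 0) v v + countBefore (D.word 1) v v = 1 by omega]
      rfl
    · have hd : (D.word 1).count v = 1 := by omega
      rw [hc] at h0 ⊢; rw [hd] at h1
      rw [show countBefore (D.word 0) v v + countBefore (D.word 1) v v = 0 by omega]
      rfl
    · have hd : (D.word 1).count v = 0 := by omega
      rw [hc] at h0 ⊢; rw [hd] at h1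
      rw [show countBefore (D.word 0) v v + countBefore (D.word 1) v v = 1 by omega]
      rfl
  · rw [D.adj_of_ne h, if_neg h, add_zero]

open Matrix in
theorem mem_colorings_iff (s : Fin 2 → ZMod 2) (x : Fin k → ZMod 2) :
    (s, x) ∈ D.colorings ↔ (x, s 0 + s 1) ∈ D.intersectionGraph.adj.borderedKer := by
  have h1 : ∀ c, ∑ j, colorsBefore x c (D.word j) (s j) =
      (D.intersectionGraph.adj *ᵥ x + (s 0 + s 1) • D.intersectionGraph.adj.diag) c + x c := by
    intro c
    rw [Fin.sum_univ_two, colorsBefore_eq, colorsBefore_eq, add_add_add_comm,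
      ← Finset.sum_add_distrib]
    simp only [← mul_add, ← Nat.cast_add, countBefore_eq_adj]
    rw [count_one_eq, ← mul_add]
    simp only [mul_add, Finset.sum_add_distrib, mul_ite, mul_one, mul_zero, Finset.sum_ite_eq',
      Finset.mem_univ, if_true, Pi.add_apply, Pi.smul_apply, smul_eq_mul, Matrix.diag_apply,
      adj_self, Matrix.mulVec, dotProduct]
    have : ∀ v, D.intersectionGraph.adj c v = D.intersectionGraph.adj v c :=
      fun v => congrFun (congrFun D.adj_isSymm v) c
    simp only [this, mul_comm (x _)]
    ring
  have h2 : ∀ j, jump x (D.word j) = D.intersectionGraph.adj.diag ⬝ᵥ x := by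
    intro j
    simp only [jump_eq, dotProduct, Matrix.diag_apply, adj_self]
    refine Finset.sum_congr rfl fun v _ => ?_
    fin_cases j
    · rfl
    · exact congrArg (· * x v) (D.count_one_eq v)
  change ((∀ c, _ = _) ∧ ∀ j, _ = _) ↔ (_ = _ ∧ _ = _)
  simp only [h1, h2, add_eq_right, forall_const, funext_iff, Pi.zero_apply]

/-- The number of components after smoothing the chords and closing. -/
theorem finrank_colorings : Module.finrank (ZMod 2) D.colorings =
    Module.finrank (ZMod 2) D.intersectionGraph.adj.borderedKer + 1 := by
  -- Only the sum of the two initial colors is constrained; the color of string `0` is the extra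
  -- free coordinate.
  have h2 : ∀ s t : ZMod 2, s + (s + t) = t := by decide
  have e : D.colorings ≃ₗ[ZMod 2] D.intersectionGraph.adj.borderedKer × ZMod 2 :=
    { toFun := fun z => (⟨(z.1.2, z.1.1 0 + z.1.1 1), (D.mem_colorings_iff _ _).1 z.2⟩, z.1.1 0)
      invFun := fun z => ⟨(![z.2, z.2 + z.1.1.2], z.1.1.1), (D.mem_colorings_iff _ _).2 (by
        simp [h2])⟩
      map_add' := fun z z' => by
        ext
        · simp
        · simp; ring
        · simp
      map_smul' := fun r z => by
        ext
        · simp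
        · simp; ring
        · simp
      left_inv := fun z => by
        ext j
        · fin_cases j <;> simp [h2]
        · simp
      right_inv := fun z => by
        ext
        · simp
        · simp [h2]
        · simp }
  rw [e.finrank_eq, Module.finrank_prod, Module.finrank_self]

end ChordDiagram

/-! ### Every chord diagram is realized by a singular string link -/

theorem exists_perm_two {X : Type*} [DecidableEq X] {a b a' b' : X} (h : a ≠ b) (h' : a' ≠ b') :
    ∃ π : Equiv.Perm X, π a = a' ∧ π b = b' := by
  refine ⟨Equiv.swap (Equiv.swap a a' b) b' * Equiv.swap a a', ?_, by simp⟩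
  rw [Equiv.Perm.mul_apply, Equiv.swap_apply_left, Equiv.swap_apply_of_ne_of_ne _ h']
  intro h1
  exact h (Equiv.swap a a' |>.injective (by rw [← h1, Equiv.swap_apply_left]))

namespace SLetter

variable {n k : ℕ}

theorem moveWord_append (w w' : List (SLetter n k)) (p : Fin (n + 1)) :
    moveWord (w ++ w') p = moveWord w' (moveWord w p) := by
  induction w generalizing p with
  | nil => rfl
  | cons s w ih => exact ih _

theorem encountersWord_append (w w' : List (SLetter n k)) (p : Fin (n + 1)) :
    encountersWord (w ++ w') p = encountersWord w p ++ encountersWord w' (moveWord w p) := by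
  induction w generalizing p with
  | nil => rfl
  | cons s w ih => simp [encountersWord, moveWord, ih]

theorem encountersWord_eq_nil {w : List (SLetter n k)} (hw : w.flatMap doublePoints = [])
    (p : Fin (n + 1)) : encountersWord w p = [] :=
  List.subset_nil.1 (hw ▸ encountersWord_subset w p)

/-- Every permutation is realized by a braid. -/
theorem exists_word_of_perm (ρ : Equiv.Perm (Fin (n + 1))) :
    ∃ w : List (SLetter n k), w.flatMap doublePoints = [] ∧ ∀ p, moveWord w p = ρ p := by
  have hρ : ρ ∈ Submonoid.closure
      (Set.range fun i : Fin n => Equiv.swap i.castSucc i.succ) := by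
    rw [Equiv.Perm.mclosure_swap_castSucc_succ]; trivial
  induction hρ using Submonoid.closure_induction with
  | mem x hx =>
    obtain ⟨i, rfl⟩ := hx
    exact ⟨[pos i], rfl, fun p => rfl⟩
  | one => exact ⟨[], rfl, fun p => rfl⟩
  | mul x y _ _ hx hy =>
    obtain ⟨w, hw, hm⟩ := hx
    obtain ⟨w', hw', hm'⟩ := hy
    exact ⟨w' ++ w, by rw [List.flatMap_append, hw, hw']; rfl, fun p => by
      rw [moveWord_append, hm', hm, Equiv.Perm.mul_apply]⟩

/-- A pure singular braid with one double point, between two given strands. -/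
theorem exists_word_of_chord (c : Fin k) {a b : Fin (n + 1)} (h : a ≠ b) :
    ∃ w : List (SLetter n k), w.flatMap doublePoints = [c] ∧ (∀ p, moveWord w p = p) ∧
      ∀ p, encountersWord w p = if p = a ∨ p = b then [c] else [] := by
  have hn : 0 < n := by
    by_contra hn
    exact h (Fin.ext (by omega))
  obtain ⟨i⟩ : Nonempty (Fin n) := ⟨⟨0, hn⟩⟩
  obtain ⟨ρ, ha, hb⟩ := exists_perm_two h (show i.castSucc ≠ i.succ by simp [Fin.ext_iff])
  obtain ⟨u, hu, hu'⟩ := exists_word_of_perm (k := k) ρ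
  obtain ⟨v, hv, hv'⟩ := exists_word_of_perm (k := k) ρ⁻¹
  -- The two strands are made adjacent, meet, and are put back; the crossing after the double point
  -- undoes its transposition.
  refine ⟨u ++ ([dbl i c, pos i] ++ v), ?_, fun p => ?_, fun p => ?_⟩
  · simp only [List.flatMap_append, hu, hv]
    rfl
  · simp [moveWord_append, hu', hv', moveWord, move, place]
  · rw [encountersWord_append, encountersWord_append, encountersWord_eq_nil hu,
      encountersWord_eq_nil hv, hu']
    have h1 : ρ p = i.castSucc ↔ p = a := by rw [← ha, ρ.injective.eq_iff]
    have h2 : ρ p = i.succ ↔ p = b := by rw [← hb, ρ.injective.eq_iff]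
    simp [encountersWord, encounters, place, doublePoints, h1, h2]
    exact ite_self _

/-- A pure singular braid with given double points between given strands. -/
theorem exists_word_of_chords (cs : List (Fin k)) (a b : Fin k → Fin (n + 1))
    (h : ∀ c, a c ≠ b c) :
    ∃ w : List (SLetter n k), w.flatMap doublePoints = cs ∧ (∀ p, moveWord w p = p) ∧
      ∀ p, encountersWord w p = cs.flatMap fun c => if p = a c ∨ p = b c then [c] else [] := by
  induction cs with
  | nil => exact ⟨[], rfl, fun _ => rfl, fun _ => rfl⟩
  | cons c cs ih =>
    obtain ⟨w, hw, hm, he⟩ := ih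
    obtain ⟨u, hu, hum, hue⟩ := exists_word_of_chord c (h c)
    refine ⟨u ++ w, by rw [List.flatMap_append, hw, hu]; rfl, fun p => ?_, fun p => ?_⟩
    · rw [moveWord_append, hum, hm]
    · rw [encountersWord_append, hum, he, hue, List.flatMap_cons]

theorem flatMap_ite_eq (l : List (Fin k)) (d : Fin k) :
    (l.flatMap fun c => if d = c then [c] else []) = List.replicate (l.count d) d := by
  induction l with
  | nil => rfl
  | cons c l ih =>
    rw [List.flatMap_cons, ih, List.count_cons]
    by_cases h : d = c
    · subst h
      simp [List.replicate_succ]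
    · simp [h, Ne.symm h]

/-- A singular braid with a given permutation in which the strand at the place `p` meets at most
one double point, namely `label p`. -/
theorem exists_word_of_label {label : Fin (n + 1) → Option (Fin k)}
    (h : ∀ c, (Finset.univ.filter fun p => label p = some c).card = 2)
    (ρ : Equiv.Perm (Fin (n + 1))) :
    ∃ w : List (SLetter n k), w.flatMap doublePoints = List.finRange k ∧
      (∀ p, moveWord w p = ρ p) ∧ ∀ p, encountersWord w p = (label p).toList := by
  have hab : ∀ c, ∃ a b, a ≠ b ∧ ∀ p, p = a ∨ p = b ↔ label p = some c := by
    intro c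
    obtain ⟨a, b, hab, he⟩ := Finset.card_eq_two.1 (h c)
    refine ⟨a, b, hab, fun p => ?_⟩
    have := congrArg (p ∈ ·) he
    simpa using this.symm
  choose a b hne hab using hab
  obtain ⟨w, hw, hm, he⟩ := exists_word_of_chords (List.finRange k) a b hne
  obtain ⟨u, hu, hum⟩ := exists_word_of_perm (k := k) ρ
  refine ⟨w ++ u, by rw [List.flatMap_append, hw, hu, List.append_nil], fun p => ?_, fun p => ?_⟩
  · rw [moveWord_append, hm, hum]
  · rw [encountersWord_append, encountersWord_eq_nil hu, List.append_nil, he]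
    simp only [hab]
    cases label p with
    | none => simp
    | some d => simp [flatMap_ite_eq, List.count_eq_one_of_mem (List.nodup_finRange k)]

end SLetter

section Words

variable {k : ℕ}

theorem sum_getElem?_eq_count (W : List (Fin k)) (c : Fin k) :
    ∑ t : Fin (W.length + 1), (if W[(t : ℕ)]? = some c then 1 else 0) = W.count c := by
  induction W with
  | nil => simp
  | cons u W ih =>
    change ∑ t : Fin (W.length + 1 + 1), _ = _
    rw [Fin.sum_univ_succ, List.count_cons, ← ih, add_comm]
    by_cases h : u = c <;> simp [h]

theorem flatten_ofFn_getElem? (W : List (Fin k)) :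
    (List.ofFn fun t : Fin (W.length + 1) => W[(t : ℕ)]?.toList).flatten = W := by
  induction W with
  | nil => simp
  | cons u W ih =>
    change (List.ofFn fun t : Fin (W.length + 1 + 1) => _).flatten = _
    rw [List.ofFn_succ, List.flatten_cons]
    simpa using ih

theorem length_eq_sum_count (W : List (Fin k)) : W.length = ∑ c, W.count c := by
  induction W with
  | nil => simp
  | cons u W ih =>
    simp [List.count_cons, Finset.sum_add_distrib, ih]

end Words

namespace ChordDiagram

variable {k : ℕ} (D : ChordDiagram 2 k)

theorem sum_length : ∑ j, (D.word j).length = 2 * k := by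
  simp only [length_eq_sum_count]
  rw [Finset.sum_comm]
  simp [D.two_endpoints, mul_comm]

/-- An enumeration of the arcs of the diagram starting with the bottom arcs. -/
theorem exists_arc_equiv :
    ∃ e : (Σ j : Fin 2, Fin ((D.word j).length + 1)) ≃ Fin (2 * k + 1 + 1),
      ∀ j, (e ⟨j, 0⟩ : ℕ) = j := by
  have hcard : Fintype.card (Σ j : Fin 2, Fin ((D.word j).length + 1)) =
      Fintype.card (Fin (2 * k + 1 + 1)) := by
    have := D.sum_length
    simp only [Fintype.card_sigma, Fintype.card_fin, Finset.sum_add_distrib, this]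
    simp
  let e := Fintype.equivOfCardEq hcard
  -- An arbitrary enumeration is corrected so that the bottom arcs get the places `0` and `1`.
  obtain ⟨π, h0, h1⟩ := exists_perm_two
    (show e ⟨0, 0⟩ ≠ e ⟨1, 0⟩ by rw [e.injective.ne_iff]; simp)
    (show (0 : Fin (2 * k + 1 + 1)) ≠ 1 by simp)
  refine ⟨e.trans π, fun j => ?_⟩
  fin_cases j
  · simpa using congrArg Fin.val h0
  · simpa using congrArg Fin.val h1

/-- Every chord diagram on two strings is the diagram of a singular string link. -/
theorem exists_singularStringLink : ∃ L : SingularStringLink 2 k, L.HasChordDiagram D := by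
  obtain ⟨e, he⟩ := D.exists_arc_equiv
  -- Each arc becomes one strand, and the closure leads it to the next arc of its string; the
  -- rotation returns the top arc to the bottom one.
  let ρ : Equiv.Perm (Fin (2 * k + 1 + 1)) :=
    (e.symm.trans (Equiv.sigmaCongrRight fun j => finRotate ((D.word j).length + 1))).trans e
  have hρ : ∀ j t, ρ (e ⟨j, t⟩) = e ⟨j, finRotate _ t⟩ := fun j t => by simp [ρ]
  -- An arc meets the endpoint at its upper end; the top arc of a string gets `none`.
  let letter : (Σ j : Fin 2, Fin ((D.word j).length + 1)) → Option (Fin k) :=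
    fun s => (D.word s.1)[(s.2 : ℕ)]?
  let label : Fin (2 * k + 1 + 1) → Option (Fin k) := fun p => letter (e.symm p)
  have hlabel : ∀ j t, label (e ⟨j, t⟩) = (D.word j)[(t : ℕ)]? := fun j t =>
    congrArg letter (e.symm_apply_apply _)
  obtain ⟨w, hw, hm, henc⟩ := SLetter.exists_word_of_label (label := label) (fun c => by
    rw [Finset.card_filter, ← e.sum_comp, Fintype.sum_sigma]
    simp only [hlabel, sum_getElem?_eq_count]
    exact D.two_endpoints c) ρ
  refine ⟨⟨2 * k + 1, w, by rw [hw], fun j => List.ofFn fun t => e ⟨j, t⟩, fun j => ?_,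
    fun j => ?_, fun j => ?_, ?_⟩, fun j => ?_⟩
  · simp [List.ofFn_succ, he]
  · rw [List.isChain_iff_getElem]
    intro i hi
    simp only [List.length_ofFn] at hi
    simp only [List.getElem_ofFn, hm, hρ]
    congr 2
    rw [finRotate_apply]
    ext
    rw [Fin.val_add_one_of_lt (by simp [Fin.lt_def]; omega)]
  · rw [List.ofFn_succ', List.concat_eq_append, List.getLast?_append]
    simp [hm, hρ, he]
  · rw [List.perm_ext_iff_of_nodup _ (List.nodup_finRange _)]
    · intro p
      simp only [List.mem_flatten, List.mem_ofFn, List.mem_finRange, iff_true]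
      exact ⟨_, ⟨(e.symm p).1, rfl⟩, List.mem_ofFn.2 ⟨(e.symm p).2, by simp⟩⟩
    · rw [List.nodup_flatten]
      refine ⟨fun l hl => ?_, ?_⟩
      · obtain ⟨j, rfl⟩ := List.mem_ofFn.1 hl
        exact List.nodup_ofFn.2 fun t t' h => by simpa using e.injective h
      · rw [List.pairwise_ofFn]
        intro i j hij p hi hj
        obtain ⟨t, rfl⟩ := List.mem_ofFn.1 hi
        obtain ⟨t', h⟩ := List.mem_ofFn.1 hj
        exact hij.ne (congrArg Sigma.fst (e.injective h)).symm
  · simp only [List.flatMap_def, List.map_ofFn, Function.comp_def, henc, hlabel]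
    exact flatten_ofFn_getElem? _

end ChordDiagram

theorem theoremT (P : ∀ n : ℕ, Braid n → LaurentLM) (hP : IsFramedHomfly P)
    {K : Type*} [Field K] [CharZero K] (a b : K) (ha : a ≠ 0)
    (k : ℕ) (D : ChordDiagram 2 k) (r : ℕ) (hr : r = D.intersectionGraph.adj.rank) :
    (Odd r → IsHomflyWeight P a b D (a ^ k * b ^ (k - r))) ∧
    (Even r → IsHomflyWeight P a b D (a ^ k * b ^ (k - r + 1))) := by
  obtain ⟨hodd, heven⟩ := D.adj_isSymm.finrank_borderedKer
  rw [← hr, Fintype.card_fin] at hodd heven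
  refine ⟨fun h => ⟨D.exists_singularStringLink, fun L hL => ?_⟩,
    fun h => ⟨D.exists_singularStringLink, fun L hL => ?_⟩⟩
  -- The exponent is the dimension of the bordered kernel, one less than the number of components of
  -- the smoothing.
  · rw [← hodd h, ← Nat.add_sub_cancel (n := Module.finrank _ _) (m := 1), ← D.finrank_colorings]
    exact L.coeff_homflySeries hP ha b hL
  · rw [← heven h, ← Nat.add_sub_cancel (n := Module.finrank _ _) (m := 1), ← D.finrank_colorings]
    exact L.coeff_homflySeries hP ha b hL
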